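/- Let $M$ be a connected smooth manifold (Hausdorff, second countable, without boundary) of dimension $n$, and let $g$ be a smooth semi-Riemannian metric on $M$, i.e. a smooth field of symmetric nondegenerate bilinear forms $g_p$ on the tangent spaces $T_pM$, of signature $(k,l)$ ($k$ minus signs and $l$ plus signs at every point). Let $\operatorname{Isom}(M,g)$ be the group of all smooth diffeomorphisms $\psi\colon M\to M$ with $\psi^*g=g$, equipped with the compact-open topology. Let $O(M)$ be the orthonormal frame bundle, that is, the set of all pairs $F=(p,(e_1,\dots,e_{k+l}))$ of a point $p\in M$ and an ordered basis of $T_pM$ with $g_p(e_i,e_j)=\varepsilon_i\delta_{ij}$, where $\varepsilon_1=\dots=\varepsilon_k=-1$ and $\varepsilon_{k+1}=\dots=\varepsilon_{k+l}=1$, with its topology as a subspace of $M\times(TM)^{k+l}$. The group $\operatorname{Isom}(M,g)$ acts on $O(M)$ by $$\psi\cdot(p,(e_i)_i)=(\psi(p),(D_p\psi(e_i))_i).$$ Then: 1. This action is free: if $\psi\cdot F=F$ for some $\psi\in\operatorname{Isom}(M,g)$ and some $F\in O(M)$, then $\psi=\mathrm{id}_M$. 2. This action is proper: the map $\operatorname{Isom}(M,g)\times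 O(M)\to O(M)\times O(M)$, $(\psi,F)\mapsto(\psi\cdot F,F)$, is continuous and proper (in particular the action is continuous). -/

import Mathlib

open scoped Manifold ContDiff

/-- A smooth semi-Riemannian metric on an `n`-dimensional smooth manifold `M`: a smooth section `p ↦ g_p`
of the bundle of bilinear forms on the tangent spaces, symmetric and nondegenerate at every point. -/
structure SemiRiemannianMetric (n : ℕ) (M : Type*) [TopologicalSpace M]
    [ChartedSpace (EuclideanSpace ℝ (Fin n)) M] [IsManifold (𝓡 n) ∞ M] where
  /-- The bilinear form `g_p` on `T_p M`. -/
  val (p : M) : TangentSpace (𝓡 n) p →L[ℝ] TangentSpace (𝓡 n) p →L[ℝ] ℝ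
  symm (p : M) (v w : TangentSpace (𝓡 n) p) : val p v w = val p w v
  nondegenerate (p : M) (v : TangentSpace (𝓡 n) p) (hv : ∀ w, val p v w = 0) : v = 0
  contMDiff : ContMDiff (𝓡 n)
    ((𝓡 n).prod 𝓘(ℝ, EuclideanSpace ℝ (Fin n) →L[ℝ] EuclideanSpace ℝ (Fin n) →L[ℝ] ℝ)) ∞
    (fun p ↦ Bundle.TotalSpace.mk'
      (EuclideanSpace ℝ (Fin n) →L[ℝ] EuclideanSpace ℝ (Fin n) →L[ℝ] ℝ) p (val p))

namespace SemiRiemannianMetric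

variable {n : ℕ} {M : Type*} [TopologicalSpace M]
  [ChartedSpace (EuclideanSpace ℝ (Fin n)) M] [IsManifold (𝓡 n) ∞ M]

/-- The entries of the diagonal matrix `diag(-1, …, -1, 1, …, 1)` with `k` entries `-1` and `l`
entries `1`: the scalar product of the standard basis vectors of `ℝ^{k,l}`. -/
def eta (k l : ℕ) (i j : Fin k ⊕ Fin l) : ℝ :=
  if i = j then Sum.elim (fun _ ↦ -1) (fun _ ↦ 1) i else 0

/-- An ordered basis of `T_p M` is `g`-orthonormal (with its `k` timelike vectors first): the linear
map `ℝ^{k,l} → (T_p M, g_p)` that it determines is a linear isometry. -/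
def IsOrthonormalBasis (g : SemiRiemannianMetric n M) {k l : ℕ} {p : M}
    (b : Module.Basis (Fin k ⊕ Fin l) ℝ (TangentSpace (𝓡 n) p)) : Prop :=
  ∀ i j, g.val p (b i) (b j) = eta k l i j

/-- The metric `g` has signature `(k, l)` (`k` minus signs, `l` plus signs): at every point `p`
there is an orthonormal basis of `T_p M` with these signs. -/
def HasSignature (g : SemiRiemannianMetric n M) (k l : ℕ) : Prop :=
  ∀ p : M, ∃ b : Module.Basis (Fin k ⊕ Fin l) ℝ (TangentSpace (𝓡 n) p), g.IsOrthonormalBasis b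

/-- The isometry group `Isom(M, g)`: the smooth diffeomorphisms `ψ` of `M` with `ψ^* g = g`,
under composition. -/
def isometryGroup (g : SemiRiemannianMetric n M) : Subgroup (M ≃ₜ M) where
  carrier := {ψ | ContMDiff (𝓡 n) (𝓡 n) ∞ ψ ∧ ContMDiff (𝓡 n) (𝓡 n) ∞ ψ.symm ∧
    ∀ (p : M) (v w : TangentSpace (𝓡 n) p),
      g.val (ψ p) (mfderiv (𝓡 n) (𝓡 n) ψ p v) (mfderiv (𝓡 n) (𝓡 n) ψ p w) = g.val p v w}
  mul_mem' := by
    rintro ψ φ ⟨h1, h2, h3⟩ ⟨h4, h5, h6⟩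
    refine ⟨h1.comp h4, h5.comp h2, fun p v w ↦ ?_⟩
    have key : mfderiv (𝓡 n) (𝓡 n) (ψ * φ : M ≃ₜ M) p =
        (mfderiv (𝓡 n) (𝓡 n) ψ (φ p)).comp (mfderiv (𝓡 n) (𝓡 n) φ p) :=
      mfderiv_comp p (h1.mdifferentiable (by simp) _) (h4.mdifferentiable (by simp) _)
    rw [key]
    exact (h3 _ _ _).trans (h6 p v w)
  one_mem' := by
    refine ⟨contMDiff_id, contMDiff_id, fun p v w ↦ ?_⟩
    have key : mfderiv (𝓡 n) (𝓡 n) (1 : M ≃ₜ M) p = ContinuousLinearMap.id ℝ _ := mfderiv_id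
    rw [key]
    rfl
  inv_mem' := by
    rintro ψ ⟨h1, h2, h3⟩
    refine ⟨h2, h1, fun p v w ↦ ?_⟩
    obtain ⟨q, rfl⟩ := ψ.surjective p
    have key : (mfderiv (𝓡 n) (𝓡 n) ψ (ψ.symm (ψ q))).comp
        (mfderiv (𝓡 n) (𝓡 n) ψ.symm (ψ q)) = ContinuousLinearMap.id ℝ _ := by
      rw [← mfderiv_comp (ψ q) (h1.mdifferentiable (by simp) _) (h2.mdifferentiable (by simp) _)]
      have : (ψ ∘ ψ.symm : M → M) = id := by ext; simp
      rw [this]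
      exact mfderiv_id
    have h := h3 (ψ.symm (ψ q)) (mfderiv (𝓡 n) (𝓡 n) ψ.symm (ψ q) v)
      (mfderiv (𝓡 n) (𝓡 n) ψ.symm (ψ q) w)
    have hv := DFunLike.congr_fun key v
    have hw := DFunLike.congr_fun key w
    rw [ContinuousLinearMap.comp_apply] at hv hw
    rw [hv, hw] at h
    have h' := h.symm
    rw [ψ.apply_symm_apply] at h'
    exact h'

/-- `Isom(M, g)` carries the compact-open topology, as a space of maps `M → M`. -/
instance (g : SemiRiemannianMetric n M) : TopologicalSpace g.isometryGroup :=
  TopologicalSpace.induced (fun ψ ↦ (⟨ψ.1, ψ.1.continuous⟩ : C(M, M))) inferInstance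

/-- An isometry as a diffeomorphism. -/
def toDiffeomorph {g : SemiRiemannianMetric n M} (ψ : g.isometryGroup) : M ≃ₘ⟮𝓡 n, 𝓡 n⟯ M where
  toEquiv := ψ.1.toEquiv
  contMDiff_toFun := ψ.2.1
  contMDiff_invFun := ψ.2.2.1

/-- The differential `D_p ψ : T_p M → T_{ψ(p)} M` of an isometry, as a linear isomorphism. -/
noncomputable def differential {g : SemiRiemannianMetric n M} (ψ : g.isometryGroup) (p : M) :
    TangentSpace (𝓡 n) p ≃L[ℝ] TangentSpace (𝓡 n) (ψ.1 p) :=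
  (toDiffeomorph ψ).mfderivToContinuousLinearEquiv (x := p) (by simp)

theorem differential_apply {g : SemiRiemannianMetric n M} (ψ : g.isometryGroup) (p : M)
    (v : TangentSpace (𝓡 n) p) : differential ψ p v = mfderiv (𝓡 n) (𝓡 n) ψ.1 p v := rfl

/-- The orthonormal frame bundle `O(M)` of a metric of signature `(k, l)`: pairs of a point `p` and
an ordered orthonormal basis of `T_p M`. -/
structure OrthonormalFrame (g : SemiRiemannianMetric n M) (k l : ℕ) where
  /-- The base point. -/
  point : M
  /-- The orthonormal basis of the tangent space at the base point. -/
  basis : Module.Basis (Fin k ⊕ Fin l) ℝ (TangentSpace (𝓡 n) point)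
  orthonormal : g.IsOrthonormalBasis basis

namespace OrthonormalFrame

variable {g : SemiRiemannianMetric n M} {k l : ℕ}

/-- The inclusion of `O(M)` into `M × TM × ⋯ × TM`. -/
noncomputable def toProd (F : OrthonormalFrame g k l) : M × (Fin k ⊕ Fin l → TangentBundle (𝓡 n) M) :=
  (F.point, fun i ↦ ⟨F.point, F.basis i⟩)

theorem toProd_injective : Function.Injective (toProd (g := g) (k := k) (l := l)) := by
  rintro ⟨p, b, hb⟩ ⟨q, c, hc⟩ h
  obtain rfl : p = q := congrArg Prod.fst h
  have : b = c := by
    refine Module.Basis.eq_of_apply_eq fun i ↦ ?_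
    have hi := congrFun (congrArg Prod.snd h) i
    simpa [toProd] using hi
  subst this
  rfl

/-- `O(M)` carries the topology of a subspace of `M × TM × ⋯ × TM`. -/
noncomputable instance : TopologicalSpace (OrthonormalFrame g k l) :=
  TopologicalSpace.induced toProd inferInstance

/-- The action of isometries on frames, `ψ • (p, (e_i)) = (ψ(p), (D_p ψ (e_i)))`. -/
noncomputable instance : SMul g.isometryGroup (OrthonormalFrame g k l) where
  smul ψ F :=
    { point := ψ.1 F.point
      basis := F.basis.map (differential ψ F.point).toLinearEquiv
      orthonormal := fun i j ↦ by
        rw [← F.orthonormal i j]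
        exact ψ.2.2.2 F.point (F.basis i) (F.basis j) }

theorem toProd_smul (ψ : g.isometryGroup) (F : OrthonormalFrame g k l) :
    (ψ • F).toProd =
      (ψ.1 F.point, fun i ↦ ⟨ψ.1 F.point, mfderiv (𝓡 n) (𝓡 n) ψ.1 F.point (F.basis i)⟩) := rfl

noncomputable instance : MulAction g.isometryGroup (OrthonormalFrame g k l) where
  one_smul F := by
    apply toProd_injective
    have key : mfderiv (𝓡 n) (𝓡 n) (1 : M ≃ₜ M) F.point = ContinuousLinearMap.id ℝ _ := mfderiv_id
    have h := toProd_smul (1 : g.isometryGroup) F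
    rw [Subgroup.coe_one, key] at h
    exact h
  mul_smul ψ φ F := by
    apply toProd_injective
    have key : mfderiv (𝓡 n) (𝓡 n) (ψ.1 * φ.1 : M ≃ₜ M) F.point =
        (mfderiv (𝓡 n) (𝓡 n) ψ.1 (φ.1 F.point)).comp (mfderiv (𝓡 n) (𝓡 n) φ.1 F.point) :=
      mfderiv_comp F.point (ψ.2.1.mdifferentiable (by simp) _) (φ.2.1.mdifferentiable (by simp) _)
    have h := toProd_smul (ψ * φ) F
    rw [Subgroup.coe_mul, key] at h
    exact h

end OrthonormalFrame

end SemiRiemannianMetric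

/-! An isometry preserves the Levi-Civita connection. In charts, with Christoffel symbols Γ in the
source and Γ' in the target, this says D²u(v, w) = Du(Γ(v, w)) - Γ'(Du v, Du w)
(`fderiv_fderiv_chartMap`): the second derivative is a smooth function of the 1-jet, of at most
quadratic growth in Du. Everything rests on this equation.

Freeness. Two isometries with the same 1-jet at a point solve the same system with the same data, so
they agree nearby. The set of points where the 1-jets agree is therefore open, and it is closed by
continuity, so by connectedness it is all of M (`eq_of_tmap_eq`).

A priori bounds. If ‖Du‖ ≤ Λ at a point, quadratic growth keeps ‖Du‖ ≤ 2Λ on a ball of radius c/Λ,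
with c independent of the isometry (`exists_uniform_chart_bound`). Consequently convergence in the
compact-open topology forces convergence of the derivatives: a large derivative would move nearby
points apart by a definite amount. This makes the action continuous.

Properness. By the ultrafilter criterion it is enough that the ψ_i converge whenever F_i and ψ_i •
F_i converge along an ultrafilter. Converging frames bound the derivatives at the base points, and
the a priori bounds with compactness give convergence of the tangent maps near the limit point,
jointly in index and vector (`HasTangentLimits`). The set of points where this holds is open, and
closed by a Cauchy argument with ψ_j⁻¹ψ_i (`hasTangentLimits_of_mem_closure`), hence all of M. The
limit solves the same system, so it is smooth and preserves g; the inverses converge too, so it is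
an isometry (`HasTangentLimits.exists_isometry_tendsto`). -/

open Set Filter Topology

set_option maxSynthPendingDepth 3

namespace SemiRiemannianMetric

/-! ### Christoffel symbols in a vector space and the second order equation of an isometry. -/

section Flat

variable {E : Type*} [NormedAddCommGroup E] [NormedSpace ℝ E]

/-- The Christoffel symbols of the first kind of a field `g` of bilinear forms on a vector space. -/
noncomputable def koszul (g : E → E →L[ℝ] E →L[ℝ] ℝ) (x : E) : E →L[ℝ] E →L[ℝ] E →L[ℝ] ℝ :=
  (1 / 2 : ℝ) • (fderiv ℝ g x + (fderiv ℝ g x).flip -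
    ((ContinuousLinearMap.flipₗᵢ ℝ E E ℝ : (E →L[ℝ] E →L[ℝ] ℝ) →L[ℝ] (E →L[ℝ] E →L[ℝ] ℝ)).comp
      (fderiv ℝ g x).flip))

theorem koszul_apply (g : E → E →L[ℝ] E →L[ℝ] ℝ) (x v w z : E) :
    koszul g x v w z =
      (1 / 2) * (fderiv ℝ g x v w z + fderiv ℝ g x w v z - fderiv ℝ g x z v w) := rfl

/-- The Christoffel symbols of the second kind of a field `g` of bilinear forms on a vector space. -/
noncomputable def christoffel (g : E → E →L[ℝ] E →L[ℝ] ℝ) (x : E) : E →L[ℝ] E →L[ℝ] E :=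
  (ContinuousLinearMap.compL ℝ E (E →L[ℝ] ℝ) E (g x).inverse).comp (koszul g x)

theorem christoffel_apply (g : E → E →L[ℝ] E →L[ℝ] ℝ) (x v w : E) :
    christoffel g x v w = (g x).inverse (koszul g x v w) := rfl

/-- The second derivative that an affine map with value `y` and derivative `A` at `x` must have,
where `Γ` and `Γ'` are the Christoffel symbols of the source and of the target. -/
noncomputable def affineHessian (Γ Γ' : E → E →L[ℝ] E →L[ℝ] E) (j : E × E × (E →L[ℝ] E)) :
    E →L[ℝ] E →L[ℝ] E :=
  (ContinuousLinearMap.compL ℝ E E E j.2.2).comp (Γ j.1) -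
    ((ContinuousLinearMap.compL ℝ E E E).flip j.2.2).comp ((Γ' j.2.1).comp j.2.2)

theorem affineHessian_apply (Γ Γ' : E → E →L[ℝ] E →L[ℝ] E) (x y : E) (A : E →L[ℝ] E) (v w : E) :
    affineHessian Γ Γ' (x, y, A) v w = A (Γ x v w) - Γ' y (A v) (A w) := rfl

/-- Quadratic growth in `A` is what makes derivative bounds of size Λ persist over distances of
order 1/Λ. -/
theorem norm_affineHessian_le (Γ Γ' : E → E →L[ℝ] E →L[ℝ] E) (x y : E) (A : E →L[ℝ] E) {C : ℝ}
    (hx : ‖Γ x‖ ≤ C) (hy : ‖Γ' y‖ ≤ C) :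
    ‖affineHessian Γ Γ' (x, y, A)‖ ≤ C * (‖A‖ + ‖A‖ ^ 2) := by
  have hC : 0 ≤ C := (norm_nonneg _).trans hx
  refine ContinuousLinearMap.opNorm_le_bound₂ _ (by positivity) fun v w ↦ ?_
  rw [affineHessian_apply]
  have h1 : ‖A (Γ x v w)‖ ≤ ‖A‖ * (C * ‖v‖ * ‖w‖) := by
    refine (A.le_opNorm _).trans ?_
    gcongr
    exact ((Γ x).le_opNorm₂ v w).trans (by gcongr)
  have h2 : ‖Γ' y (A v) (A w)‖ ≤ C * (‖A‖ * ‖v‖) * (‖A‖ * ‖w‖) := by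
    refine ((Γ' y).le_opNorm₂ _ _).trans ?_
    gcongr
    · exact A.le_opNorm v
    · exact A.le_opNorm w
  calc _ ≤ ‖A (Γ x v w)‖ + ‖Γ' y (A v) (A w)‖ := norm_sub_le _ _
    _ ≤ ‖A‖ * (C * ‖v‖ * ‖w‖) + C * (‖A‖ * ‖v‖) * (‖A‖ * ‖w‖) := add_le_add h1 h2
    _ = _ := by ring

theorem contDiffOn_affineHessian {Γ Γ' : E → E →L[ℝ] E →L[ℝ] E} {U V : Set E} {m : WithTop ℕ∞}
    (hΓ : ContDiffOn ℝ m Γ U) (hΓ' : ContDiffOn ℝ m Γ' V) :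
    ContDiffOn ℝ m (affineHessian Γ Γ') (U ×ˢ V ×ˢ univ) := by
  have h1 : ContDiffOn ℝ m (fun j : E × E × (E →L[ℝ] E) ↦ Γ j.1) (U ×ˢ V ×ˢ univ) :=
    hΓ.comp contDiff_fst.contDiffOn fun j hj ↦ hj.1
  have h2 : ContDiffOn ℝ m (fun j : E × E × (E →L[ℝ] E) ↦ Γ' j.2.1) (U ×ˢ V ×ˢ univ) :=
    hΓ'.comp (contDiff_fst.comp contDiff_snd).contDiffOn fun j hj ↦ hj.2.1
  have h3 : ContDiffOn ℝ m (fun j : E × E × (E →L[ℝ] E) ↦ j.2.2) (U ×ˢ V ×ˢ univ) :=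
    (contDiff_snd.comp contDiff_snd).contDiffOn
  exact (((ContinuousLinearMap.compL ℝ E E E).contDiff.comp_contDiffOn h3).clm_comp h1).sub
    (((ContinuousLinearMap.compL ℝ E E E).flip.contDiff.comp_contDiffOn h3).clm_comp
      (h2.clm_comp h3))

/-- A bilinear form is invertible if it is nondegenerate in the first variable. -/
theorem isInvertible_of_nondegenerate [FiniteDimensional ℝ E] (b : E →L[ℝ] E →L[ℝ] ℝ)
    (hb : ∀ v, (∀ w, b v w = 0) → v = 0) : b.IsInvertible := by
  have hinj : Function.Injective b := by
    rw [injective_iff_map_eq_zero]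
    exact fun v hv ↦ hb v fun w ↦ by simp [hv]
  have hdim : Module.finrank ℝ E = Module.finrank ℝ (E →L[ℝ] ℝ) := by
    rw [← (LinearMap.toContinuousLinearMap : (E →ₗ[ℝ] ℝ) ≃ₗ[ℝ] (E →L[ℝ] ℝ)).finrank_eq]
    exact (Subspace.dual_finrank_eq (K := ℝ) (V := E)).symm
  let e : E ≃ₗ[ℝ] (E →L[ℝ] ℝ) :=
    LinearMap.linearEquivOfInjective (b : E →ₗ[ℝ] (E →L[ℝ] ℝ)) hinj hdim
  exact ⟨e.toContinuousLinearEquiv, by ext v w; rfl⟩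

theorem apply_christoffel [FiniteDimensional ℝ E] {g : E → E →L[ℝ] E →L[ℝ] ℝ} {x : E}
    (hg : ∀ v, (∀ w, g x v w = 0) → v = 0) (v w : E) :
    g x (christoffel g x v w) = koszul g x v w := by
  rw [christoffel_apply, (isInvertible_of_nondegenerate _ hg).self_apply_inverse]

theorem contDiffOn_christoffel [FiniteDimensional ℝ E] {g : E → E →L[ℝ] E →L[ℝ] ℝ} {U : Set E}
    (hU : IsOpen U) (hg : ContDiffOn ℝ ∞ g U) (hnd : ∀ x ∈ U, ∀ v, (∀ w, g x v w = 0) → v = 0) :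
    ContDiffOn ℝ ∞ (christoffel g) U := by
  have : CompleteSpace E := FiniteDimensional.complete ℝ E
  have hD : ContDiffOn ℝ ∞ (fderiv ℝ g) U := hg.fderiv_of_isOpen hU (by simp)
  have hflip : ContDiffOn ℝ ∞ (fun x ↦ (fderiv ℝ g x).flip) U :=
    (ContinuousLinearMap.flipₗᵢ ℝ E E (E →L[ℝ] ℝ)).toContinuousLinearEquiv.contDiff.comp_contDiffOn
      hD
  have hK : ContDiffOn ℝ ∞ (koszul g) U :=
    ((hD.add hflip).sub (contDiffOn_const.clm_comp hflip)).const_smul _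
  have hinv : ContDiffOn ℝ ∞ (fun x ↦ (g x).inverse) U := by
    intro x hx
    obtain ⟨e, he⟩ := isInvertible_of_nondegenerate _ (hnd x hx)
    have h1 := contDiffAt_map_inverse (n := ∞) e
    rw [he] at h1
    exact h1.comp_contDiffWithinAt x (hg x hx)
  exact ((ContinuousLinearMap.compL ℝ E (E →L[ℝ] ℝ) E).contDiff.comp_contDiffOn hinv).clm_comp hK

/-- An isometry between fields of bilinear forms is affine for the Levi-Civita connections. -/
theorem fderiv_fderiv_eq_affineHessian [FiniteDimensional ℝ E] {g h : E → E →L[ℝ] E →L[ℝ] ℝ}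
    {u : E → E} {W : Set E} (hW : IsOpen W) (hu : ContDiffOn ℝ 2 u W)
    (hiso : ∀ x ∈ W, ∀ v w, h (u x) (fderiv ℝ u x v) (fderiv ℝ u x w) = g x v w)
    {x : E} (hx : x ∈ W) (hgx : DifferentiableAt ℝ g x) (hhx : DifferentiableAt ℝ h (u x))
    (hgnd : ∀ v, (∀ w, g x v w = 0) → v = 0) (hhnd : ∀ v, (∀ w, h (u x) v w = 0) → v = 0)
    (hhs : ∀ v w, h (u x) v w = h (u x) w v) :
    fderiv ℝ (fderiv ℝ u) x = affineHessian (christoffel g) (christoffel h) (x, u x, fderiv ℝ u x) := by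
  have hud : HasFDerivAt u (fderiv ℝ u x) x :=
    ((hu.differentiableOn (by simp)).differentiableAt (hW.mem_nhds hx)).hasFDerivAt
  have hdd : HasFDerivAt (fderiv ℝ u) (fderiv ℝ (fderiv ℝ u) x) x :=
    (((hu.fderiv_of_isOpen hW (m := 1) (by norm_num)).differentiableOn (by simp)).differentiableAt
      (hW.mem_nhds hx)).hasFDerivAt
  have hsymm : ∀ v w, fderiv ℝ (fderiv ℝ u) x v w = fderiv ℝ (fderiv ℝ u) x w v := fun v w ↦ by
    have := (hu.contDiffAt (hW.mem_nhds hx)).isSymmSndFDerivAt (by simp)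
    exact this v w
  set A := fderiv ℝ u x with hA
  set D := fderiv ℝ (fderiv ℝ u) x with hD
  -- Derivative in the direction `z` of the identity h(u)(Du v, Du w) = g(v, w).
  have hder : ∀ v w z, fderiv ℝ h (u x) (A z) (A v) (A w) + h (u x) (D z v) (A w) +
      h (u x) (A v) (D z w) = fderiv ℝ g x z v w := by
    intro v w z
    have h1 : HasFDerivAt (fun x ↦ h (u x)) ((fderiv ℝ h (u x)).comp A) x :=
      hhx.hasFDerivAt.comp x hud
    have h2 := (h1.clm_apply (hdd.clm_apply (hasFDerivAt_const v x))).clm_apply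
      (hdd.clm_apply (hasFDerivAt_const w x))
    have h3 := (hgx.hasFDerivAt.clm_apply (hasFDerivAt_const v x)).clm_apply
      (hasFDerivAt_const w x)
    have h4 := h2.congr_of_eventuallyEq (f₁ := fun x ↦ g x v w) (by
      filter_upwards [hW.mem_nhds hx] with y hy using (hiso y hy v w).symm)
    have h5 := DFunLike.congr_fun (h4.unique h3) z
    simp [← hA] at h5
    linarith
  have hinj : Function.Injective A := by
    rw [injective_iff_map_eq_zero]
    exact fun v hv ↦ hgnd v fun w ↦ by rw [← hiso x hx, ← hA, hv]; simp
  have hsurj : Function.Surjective A :=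
    LinearMap.surjective_of_injective (f := (A : E →ₗ[ℝ] E)) hinj
  ext v w : 2
  rw [affineHessian_apply, ← sub_eq_zero]
  refine hhnd _ fun z' ↦ ?_
  obtain ⟨z, rfl⟩ := hsurj z'
  have e1 : h (u x) (A (christoffel g x v w)) (A z) = koszul g x v w z := by
    rw [hiso x hx, apply_christoffel hgnd]
  have e2 : h (u x) (christoffel h (u x) (A v) (A w)) (A z) = koszul h (u x) (A v) (A w) (A z) := by
    rw [apply_christoffel hhnd]
  rw [map_sub, map_sub, _root_.sub_apply, _root_.sub_apply, e1, e2,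
    koszul_apply, koszul_apply]
  -- Koszul's trick: in `k1 + k2 - k3` the symmetry of D²u and of h cancels all Hessian terms except
  -- 2 h(D v w, A z).
  have k1 := hder w z v
  have k2 := hder v z w
  have k3 := hder v w z
  rw [hsymm z v, hsymm z w] at k3
  rw [hsymm w v] at k2
  rw [hhs (D v z)] at k3
  linarith

end Flat

/-! ### Propagation of bounds, uniqueness and regularity for D²u = F(x, u, Du). -/

section FlatEstimates

open Metric

variable {E : Type*} [NormedAddCommGroup E] [NormedSpace ℝ E]

/-- A bound on the derivative at one point propagates to a ball of controlled radius if the second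
derivative is controlled quadratically by the derivative. -/
theorem norm_fderiv_lt_of_hessian_le {u : E → E} {W : Set E} (hW : IsOpen W)
    (hu : ContDiffOn ℝ 2 u W) {x y₀ : E} {ρ C Λ r : ℝ} (hC : 0 ≤ C) (hΛ : 1 ≤ Λ)
    (hr : 0 < r) (hrρ : 2 * Λ * r ≤ ρ) (hrC : 12 * C * Λ * r ≤ 1)
    (hess : ∀ x' ∈ W, x' ∈ ball x r → u x' ∈ closedBall y₀ (2 * ρ) →
      ‖fderiv ℝ (fderiv ℝ u) x'‖ ≤ C * (‖fderiv ℝ u x'‖ + ‖fderiv ℝ u x'‖ ^ 2))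
    (hcl : ∀ x' ∈ ball x r, x' ∈ closure (W ∩ u ⁻¹' closedBall y₀ (2 * ρ)) → x' ∈ W)
    (hx : x ∈ W) (hxy : u x ∈ ball y₀ ρ) (hxΛ : ‖fderiv ℝ u x‖ ≤ Λ) :
    ∀ x' ∈ ball x r, x' ∈ W ∧ u x' ∈ ball y₀ (2 * ρ) ∧ ‖fderiv ℝ u x'‖ < 2 * Λ := by
  intro x' hx'
  -- Continuity argument: follow the segment from `x` to `x'` up to its first exit time `t` from the
  -- open set `P`. Up to `t` the closed bounds hold, so `u` has moved by less than 2Λr ≤ ρ; the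
  -- Hessian is at most C(2Λ + 4Λ²) ≤ 6CΛ², so Du has changed by at most 6CΛ²r ≤ Λ/2. Both strict
  -- bounds thus still hold at `t`, and `hcl` keeps γ t in `W`, so no exit occurs.
  set P : Set E := {z | z ∈ W ∧ u z ∈ ball y₀ (2 * ρ) ∧ ‖fderiv ℝ u z‖ < 2 * Λ} with hP
  have hDc : ContinuousOn (fderiv ℝ u) W := hu.continuousOn_fderiv_of_isOpen hW (by norm_num)
  have hDd : ∀ z ∈ W, HasFDerivAt (fderiv ℝ u) (fderiv ℝ (fderiv ℝ u) z) z := fun z hz ↦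
    (((hu.fderiv_of_isOpen hW (m := 1) (by norm_num)).differentiableOn (by simp)).differentiableAt
      (hW.mem_nhds hz)).hasFDerivAt
  have hud : ∀ z ∈ W, HasFDerivAt u (fderiv ℝ u z) z := fun z hz ↦
    ((hu.differentiableOn (by simp)).differentiableAt (hW.mem_nhds hz)).hasFDerivAt
  have hρ : 0 < ρ := lt_of_lt_of_le (by positivity) hrρ
  have hPo : IsOpen P := by
    have h1 := hu.continuousOn.isOpen_inter_preimage hW (isOpen_ball (x := y₀) (ε := 2 * ρ))
    have h2 := hDc.isOpen_inter_preimage hW (isOpen_ball (x := (0 : E →L[ℝ] E)) (ε := 2 * Λ))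
    convert h1.inter h2 using 1
    ext z
    simp only [hP, mem_ofPred_eq, mem_inter_iff, mem_preimage, mem_ball, dist_zero_right]
    tauto
  have hPx : x ∈ P := ⟨hx, ball_subset_ball (by linarith) hxy, by linarith⟩
  set γ : ℝ → E := fun t ↦ x + t • (x' - x) with hγ
  have hγc : Continuous γ := by fun_prop
  have hγ0 : γ 0 = x := by simp [hγ]
  have hγ1 : γ 1 = x' := by simp [hγ]
  have hd : ‖x' - x‖ < r := by simpa [dist_eq_norm] using hx'
  have hγd : ∀ t ∈ Icc (0 : ℝ) 1, ‖γ t - x‖ < r := by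
    intro t ht
    simp only [hγ, add_sub_cancel_left, norm_smul, Real.norm_eq_abs, abs_of_nonneg ht.1]
    nlinarith [ht.2, norm_nonneg (x' - x)]
  by_contra hcon
  have hK : IsCompact (Icc (0 : ℝ) 1 ∩ γ ⁻¹' Pᶜ) :=
    isCompact_Icc.inter_right (hPo.isClosed_compl.preimage hγc)
  obtain ⟨t, ⟨ht, htP⟩, htmin⟩ := hK.exists_isLeast ⟨1, by simp, by rw [mem_preimage, hγ1]; exact hcon⟩
  have hlt : ∀ s ∈ Ico (0 : ℝ) t, γ s ∈ P := by
    intro s hs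
    by_contra hsP
    exact absurd (htmin ⟨⟨hs.1, hs.2.le.trans ht.2⟩, hsP⟩) (not_le.2 hs.2)
  have ht0 : 0 < t := ht.1.lt_of_ne fun h ↦ htP (by rw [← h, hγ0]; exact hPx)
  have hcls : ∀ Q : Set E, (∀ s ∈ Ico (0 : ℝ) t, γ s ∈ Q) → γ t ∈ closure Q := by
    intro Q hQ
    have : t ∈ closure (Ico (0 : ℝ) t) := by
      rw [closure_Ico ht0.ne]; exact right_mem_Icc.2 ht.1
    exact map_mem_closure hγc this hQ
  have htW : γ t ∈ W := hcl _ (by simpa [dist_eq_norm] using hγd t ht)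
    (hcls _ fun s hs ↦ ⟨(hlt s hs).1, ball_subset_closedBall (hlt s hs).2.1⟩)
  have hwW : ∀ s ∈ Icc (0 : ℝ) t, γ s ∈ W := fun s hs ↦ by
    rcases hs.2.eq_or_lt with h | h
    · rwa [h]
    · exact (hlt s ⟨hs.1, h⟩).1
  have hwb : ∀ s ∈ Icc (0 : ℝ) t, u (γ s) ∈ closedBall y₀ (2 * ρ) ∧
      ‖fderiv ℝ u (γ s)‖ ≤ 2 * Λ := by
    have hic : ContinuousOn (fun s ↦ u (γ s)) (Icc 0 t) := hu.continuousOn.comp hγc.continuousOn hwW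
    have hDic : ContinuousOn (fun s ↦ fderiv ℝ u (γ s)) (Icc 0 t) := hDc.comp hγc.continuousOn hwW
    intro s hs
    rw [← closure_Ico ht0.ne] at hs hic hDic
    refine ⟨?_, ?_⟩
    · exact closure_minimal
        (by rintro _ ⟨s, hs, rfl⟩; exact ball_subset_closedBall (hlt s hs).2.1)
        isClosed_closedBall (hic.image_closure ⟨s, hs, rfl⟩)
    · have h := hDic.image_closure ⟨s, hs, rfl⟩
      have h' : fderiv ℝ u (γ s) ∈ closedBall (0 : E →L[ℝ] E) (2 * Λ) :=
        closure_minimal (by rintro _ ⟨s, hs, rfl⟩; simpa using (hlt s hs).2.2.le)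
          isClosed_closedBall h
      simpa using h'
  have hseg : ∀ z ∈ segment ℝ x (γ t), ∃ s ∈ Icc (0 : ℝ) t, z = γ s := by
    intro z hz
    rw [segment_eq_image'] at hz
    obtain ⟨θ, hθ, rfl⟩ := hz
    exact ⟨θ * t, ⟨mul_nonneg hθ.1 ht.1, mul_le_of_le_one_left ht.1 hθ.2⟩, by
      simp [hγ, smul_smul]⟩
  have hxs : x ∈ segment ℝ x (γ t) := left_mem_segment ℝ _ _
  have hts : γ t ∈ segment ℝ x (γ t) := right_mem_segment ℝ _ _
  have hu_le : ‖u (γ t) - u x‖ ≤ 2 * Λ * ‖γ t - x‖ :=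
    (convex_segment x (γ t)).norm_image_sub_le_of_norm_hasFDerivWithin_le
      (f' := fderiv ℝ u) (fun z hz ↦ by
        obtain ⟨s, hs, rfl⟩ := hseg z hz
        exact (hud _ (hwW s hs)).hasFDerivWithinAt)
      (fun z hz ↦ by
        obtain ⟨s, hs, rfl⟩ := hseg z hz
        exact (hwb s hs).2) hxs hts
  have hD_le : ‖fderiv ℝ u (γ t) - fderiv ℝ u x‖ ≤ 6 * C * Λ ^ 2 * ‖γ t - x‖ :=
    (convex_segment x (γ t)).norm_image_sub_le_of_norm_hasFDerivWithin_le
      (f' := fderiv ℝ (fderiv ℝ u)) (fun z hz ↦ by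
        obtain ⟨s, hs, rfl⟩ := hseg z hz
        exact (hDd _ (hwW s hs)).hasFDerivWithinAt)
      (fun z hz ↦ by
        obtain ⟨s, hs, rfl⟩ := hseg z hz
        refine (hess _ (hwW s hs) (by
          simpa [dist_eq_norm] using hγd s ⟨hs.1, hs.2.trans ht.2⟩) (hwb s hs).1).trans ?_
        have h1 := (hwb s hs).2
        calc C * (‖fderiv ℝ u (γ s)‖ + ‖fderiv ℝ u (γ s)‖ ^ 2)
            ≤ C * (2 * Λ + (2 * Λ) ^ 2) := by gcongr
          _ ≤ C * (6 * Λ ^ 2) := by gcongr; nlinarith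
          _ = _ := by ring) hxs hts
  have hgt := hγd t ht
  refine htP ⟨htW, ?_, ?_⟩
  · rw [mem_ball, dist_eq_norm] at hxy ⊢
    have : 2 * Λ * ‖γ t - x‖ ≤ ρ := le_trans (by gcongr) hrρ
    calc ‖u (γ t) - y₀‖ = ‖(u (γ t) - u x) + (u x - y₀)‖ := by congr 1; abel
      _ ≤ ‖u (γ t) - u x‖ + ‖u x - y₀‖ := norm_add_le _ _
      _ < 2 * ρ := by linarith
  · have : 6 * C * Λ ^ 2 * ‖γ t - x‖ ≤ Λ / 2 := by
      calc 6 * C * Λ ^ 2 * ‖γ t - x‖ ≤ 6 * C * Λ ^ 2 * r := by gcongr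
        _ = (12 * C * Λ * r) * (Λ / 2) := by ring
        _ ≤ 1 * (Λ / 2) := by gcongr
        _ = Λ / 2 := one_mul _
    calc ‖fderiv ℝ u (γ t)‖ = ‖(fderiv ℝ u (γ t) - fderiv ℝ u x) + fderiv ℝ u x‖ := by
          congr 1; abel
      _ ≤ ‖fderiv ℝ u (γ t) - fderiv ℝ u x‖ + ‖fderiv ℝ u x‖ := norm_add_le _ _
      _ < 2 * Λ := by linarith

/-- A second order Taylor estimate on a ball. -/
theorem norm_sub_sub_fderiv_le {u : E → E} {x x' : E} {r C : ℝ}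
    (hu : ContDiffOn ℝ 2 u (ball x r)) (hC : ∀ z ∈ ball x r, ‖fderiv ℝ (fderiv ℝ u) z‖ ≤ C)
    (hx' : x' ∈ ball x r) :
    ‖u x' - u x - fderiv ℝ u x (x' - x)‖ ≤ C * ‖x' - x‖ ^ 2 := by
  have hr : 0 < r := dist_nonneg.trans_lt hx'
  have hx : x ∈ ball x r := mem_ball_self hr
  have hC0 : 0 ≤ C := (norm_nonneg _).trans (hC x hx)
  have hDd : ∀ z ∈ ball x r, HasFDerivAt (fderiv ℝ u) (fderiv ℝ (fderiv ℝ u) z) z := fun z hz ↦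
    (((hu.fderiv_of_isOpen isOpen_ball (m := 1) (by norm_num)).differentiableOn
      (by simp)).differentiableAt (isOpen_ball.mem_nhds hz)).hasFDerivAt
  have hud : ∀ z ∈ ball x r, HasFDerivAt u (fderiv ℝ u z) z := fun z hz ↦
    ((hu.differentiableOn (by simp)).differentiableAt (isOpen_ball.mem_nhds hz)).hasFDerivAt
  have hsub : segment ℝ x x' ⊆ ball x r := (convex_ball x r).segment_subset hx hx'
  have h1 : ∀ z ∈ segment ℝ x x', ‖fderiv ℝ u z - fderiv ℝ u x‖ ≤ C * ‖x' - x‖ := fun z hz ↦ by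
    refine ((convex_ball x r).norm_image_sub_le_of_norm_hasFDerivWithin_le
      (fun z hz ↦ (hDd z hz).hasFDerivWithinAt) hC hx (hsub hz)).trans ?_
    gcongr
    exact norm_sub_le_of_mem_segment hz
  calc _ ≤ C * ‖x' - x‖ * ‖x' - x‖ :=
        (convex_segment x x').norm_image_sub_le_of_norm_hasFDerivWithin_le'
          (fun z hz ↦ (hud z (hsub hz)).hasFDerivWithinAt) h1 (left_mem_segment ℝ _ _)
          (right_mem_segment ℝ _ _)
    _ = _ := by ring

/-- Two solutions of a second order system `D²u = F(x, u, Du)` with the same value and the same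
derivative at a point agree near that point. -/
theorem eventuallyEq_of_jet_eq {F : E × E × (E →L[ℝ] E) → E →L[ℝ] E →L[ℝ] E} {u₁ u₂ : E → E}
    {x₀ : E} {N : Set E} (hN : N ∈ 𝓝 x₀) (hu₁ : ContDiffOn ℝ 2 u₁ N) (hu₂ : ContDiffOn ℝ 2 u₂ N)
    (hF : ContDiffAt ℝ 1 F (x₀, u₁ x₀, fderiv ℝ u₁ x₀))
    (he₁ : ∀ x ∈ N, fderiv ℝ (fderiv ℝ u₁) x = F (x, u₁ x, fderiv ℝ u₁ x))
    (he₂ : ∀ x ∈ N, fderiv ℝ (fderiv ℝ u₂) x = F (x, u₂ x, fderiv ℝ u₂ x))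
    (h0 : u₁ x₀ = u₂ x₀) (h1 : fderiv ℝ u₁ x₀ = fderiv ℝ u₂ x₀) : u₁ =ᶠ[𝓝 x₀] u₂ := by
  obtain ⟨K, T, hT, hK⟩ := hF.exists_lipschitzOnWith
  have hc : ∀ u : E → E, ContDiffOn ℝ 2 u N →
      ContinuousAt (fun x ↦ (x, u x, fderiv ℝ u x)) x₀ := fun u hu ↦
    continuousAt_id.prodMk (((hu.contDiffAt hN).continuousAt).prodMk
      ((hu.contDiffAt hN).continuousAt_fderiv (by norm_num)))
  have hT₁ := (hc u₁ hu₁).preimage_mem_nhds hT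
  have hT₂ := (hc u₂ hu₂).preimage_mem_nhds (by rw [← h0, ← h1]; exact hT)
  have hb : {x | ‖fderiv ℝ u₁ x - fderiv ℝ u₂ x‖ < 1} ∈ 𝓝 x₀ := by
    have : ContinuousAt (fun x ↦ ‖fderiv ℝ u₁ x - fderiv ℝ u₂ x‖) x₀ :=
      (((hu₁.contDiffAt hN).continuousAt_fderiv (by norm_num)).sub
        ((hu₂.contDiffAt hN).continuousAt_fderiv (by norm_num))).norm
    exact this.eventually_lt continuousAt_const (by simp [h1])
  obtain ⟨R, hR, hsub⟩ := Metric.mem_nhds_iff.1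
    (inter_mem (inter_mem (interior_mem_nhds.2 hN) hb) (inter_mem hT₁ hT₂))
  -- If ‖Du₁ - Du₂‖ ≤ m on the ball, then r ≤ 1 gives ‖u₁ - u₂‖ ≤ m; the Hessians then differ by at
  -- most Km, and Kr ≤ 1/2 improves the first bound to m/2. Iterating from m = 1 forces equality.
  set r : ℝ := min R (min 1 (1 / (2 * (K + 1)))) with hr
  have hK0 : (0 : ℝ) ≤ K := K.2
  have hr0 : 0 < r := by positivity
  have hrR : r ≤ R := min_le_left _ _
  have hr1 : r ≤ 1 := (min_le_right _ _).trans (min_le_left _ _)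
  have hrK : (K : ℝ) * r ≤ 1 / 2 := by
    have : r ≤ 1 / (2 * (K + 1)) := (min_le_right _ _).trans (min_le_right _ _)
    calc (K : ℝ) * r ≤ K * (1 / (2 * (K + 1))) := by gcongr
      _ ≤ 1 / 2 := by
        rw [mul_one_div, div_le_div_iff₀ (by positivity) (by positivity)]
        linarith
  have hsub' : ball x₀ r ⊆ interior N := fun z hz ↦ (hsub (ball_subset_ball hrR hz)).1.1
  have hx₀ : x₀ ∈ ball x₀ r := mem_ball_self hr0
  have hud : ∀ u : E → E, ContDiffOn ℝ 2 u N → ∀ z ∈ ball x₀ r,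
      HasFDerivAt u (fderiv ℝ u z) z ∧
      HasFDerivAt (fderiv ℝ u) (fderiv ℝ (fderiv ℝ u) z) z := by
    intro u hu z hz
    have h := (hu.mono interior_subset).contDiffAt (isOpen_interior.mem_nhds (hsub' hz))
    exact ⟨(h.differentiableAt (by simp)).hasFDerivAt,
      ((h.fderiv_right (m := 1) (by norm_num)).differentiableAt (by simp)).hasFDerivAt⟩
  have hdist : ∀ z ∈ ball x₀ r, ‖z - x₀‖ ≤ r := fun z hz ↦ by
    rw [mem_ball, dist_eq_norm] at hz; exact hz.le
  have hval : ∀ m : ℝ, 0 ≤ m → (∀ z ∈ ball x₀ r, ‖fderiv ℝ u₁ z - fderiv ℝ u₂ z‖ ≤ m) →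
      ∀ z ∈ ball x₀ r, ‖u₁ z - u₂ z‖ ≤ m := by
    intro m hm0 hm z hz
    have := (convex_ball x₀ r).norm_image_sub_le_of_norm_hasFDerivWithin_le
      (f := fun z ↦ u₁ z - u₂ z) (fun z hz ↦
        ((hud u₁ hu₁ z hz).1.sub (hud u₂ hu₂ z hz).1).hasFDerivWithinAt) hm hx₀ hz
    simp only [h0, sub_self, sub_zero] at this
    exact this.trans (mul_le_of_le_one_right hm0 ((hdist z hz).trans hr1))
  have hstep : ∀ m : ℝ, 0 ≤ m → (∀ z ∈ ball x₀ r, ‖fderiv ℝ u₁ z - fderiv ℝ u₂ z‖ ≤ m) →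
      ∀ z ∈ ball x₀ r, ‖fderiv ℝ u₁ z - fderiv ℝ u₂ z‖ ≤ m / 2 := by
    intro m hm0 hm z hz
    have hbd : ∀ z ∈ ball x₀ r,
        ‖fderiv ℝ (fderiv ℝ u₁) z - fderiv ℝ (fderiv ℝ u₂) z‖ ≤ K * m := by
      intro z hz
      have hzR := hsub (ball_subset_ball hrR hz)
      have hzN := interior_subset hzR.1.1
      rw [he₁ z hzN, he₂ z hzN]
      refine (hK.norm_sub_le hzR.2.1 hzR.2.2).trans ?_
      gcongr
      simp only [Prod.mk_sub_mk, sub_self, Prod.norm_mk, norm_zero]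
      exact max_le hm0 (max_le (hval m hm0 hm z hz) (hm z hz))
    have := (convex_ball x₀ r).norm_image_sub_le_of_norm_hasFDerivWithin_le
      (f := fun z ↦ fderiv ℝ u₁ z - fderiv ℝ u₂ z) (fun z hz ↦
        ((hud u₁ hu₁ z hz).2.sub (hud u₂ hu₂ z hz).2).hasFDerivWithinAt) hbd hx₀ hz
    simp only [h1, sub_self, sub_zero] at this
    calc _ ≤ K * m * ‖z - x₀‖ := this
      _ ≤ K * m * r := by gcongr; exact hdist z hz
      _ = (K * r) * m := by ring
      _ ≤ 1 / 2 * m := by gcongr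
      _ = m / 2 := by ring
  have hpow : ∀ k : ℕ, ∀ z ∈ ball x₀ r, ‖fderiv ℝ u₁ z - fderiv ℝ u₂ z‖ ≤ (1 / 2) ^ k := by
    intro k
    induction k with
    | zero => exact fun z hz ↦ by simpa using (hsub (ball_subset_ball hrR hz)).1.2.le
    | succ k ih =>
      intro z hz
      refine (hstep _ (by positivity) ih z hz).trans_eq ?_
      ring
  have hzero : ∀ z ∈ ball x₀ r, ‖fderiv ℝ u₁ z - fderiv ℝ u₂ z‖ ≤ 0 := fun z hz ↦
    ge_of_tendsto' (tendsto_pow_atTop_nhds_zero_of_lt_one (by norm_num) (by norm_num))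
      fun k ↦ hpow k z hz
  filter_upwards [ball_mem_nhds x₀ hr0] with z hz
  exact sub_eq_zero.1 (norm_le_zero_iff.1 (hval 0 le_rfl hzero z hz))

/-- A solution of a smooth first order system for the jet `(u, A)` is smooth. -/
theorem contDiffOn_of_hasFDerivAt_jet {F : E × E × (E →L[ℝ] E) → E →L[ℝ] E →L[ℝ] E} {u : E → E}
    {A : E → E →L[ℝ] E} {N : Set E} {T : Set (E × E × (E →L[ℝ] E))} (hN : IsOpen N)
    (hF : ContDiffOn ℝ ∞ F T) (hT : ∀ x ∈ N, (x, u x, A x) ∈ T)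
    (hu : ∀ x ∈ N, HasFDerivAt u (A x) x) (hA : ∀ x ∈ N, HasFDerivAt A (F (x, u x, A x)) x) :
    ContDiffOn ℝ ∞ u N := by
  -- Bootstrapping: if `u` and `A` are C^m, so is x ↦ F(x, u, A), which is the derivative of `A`;
  -- hence both are C^(m+1).
  have key : ∀ m : ℕ, ContDiffOn ℝ m u N ∧ ContDiffOn ℝ m A N := by
    intro m
    induction m with
    | zero =>
      simp only [Nat.cast_zero, contDiffOn_zero]
      exact ⟨fun x hx ↦ (hu x hx).continuousAt.continuousWithinAt,
        fun x hx ↦ (hA x hx).continuousAt.continuousWithinAt⟩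
    | succ m ih =>
      have hsucc : ∀ {G : Type _} [NormedAddCommGroup G] [NormedSpace ℝ G] (f : E → G)
          (f' : E → E →L[ℝ] G), (∀ x ∈ N, HasFDerivAt f (f' x) x) → ContDiffOn ℝ m f' N →
          ContDiffOn ℝ (m + 1 : ℕ) f N := by
        intro G _ _ f f' hf hf'
        push_cast
        rw [contDiffOn_succ_iff_fderiv_of_isOpen hN]
        refine ⟨fun x hx ↦ (hf x hx).differentiableAt.differentiableWithinAt, by simp, ?_⟩
        exact hf'.congr fun x hx ↦ (hf x hx).fderiv
      refine ⟨hsucc u A hu ih.2, hsucc A _ hA ?_⟩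
      exact (hF.of_le (by exact_mod_cast le_top)).comp
        (contDiff_id.contDiffOn.prodMk (ih.1.prodMk ih.2)) hT
  exact contDiffOn_infty.2 fun m ↦ (key m).1

end FlatEstimates

/-! ### Maps, metrics and tangent vectors in the preferred charts. -/

section Charts

open Metric Bundle

variable {n : ℕ} {M : Type*} [TopologicalSpace M]
  [ChartedSpace (EuclideanSpace ℝ (Fin n)) M]

/-- A map between manifolds in the preferred charts at `p` and at `q`. -/
noncomputable def chartMap (ψ : M → M) (p q : M) (x : EuclideanSpace ℝ (Fin n)) :
    EuclideanSpace ℝ (Fin n) :=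
  extChartAt (𝓡 n) q (ψ ((extChartAt (𝓡 n) p).symm x))

/-- The domain of definition of a map in the preferred charts at `p` and at `q`. -/
def chartDomain (ψ : M → M) (p q : M) : Set (EuclideanSpace ℝ (Fin n)) :=
  (extChartAt (𝓡 n) p).target ∩
    (fun x ↦ ψ ((extChartAt (𝓡 n) p).symm x)) ⁻¹' (extChartAt (𝓡 n) q).source

theorem isOpen_chartDomain {ψ : M → M} (hψ : Continuous ψ) (p q : M) :
    IsOpen (chartDomain (n := n) ψ p q) :=
  (hψ.comp_continuousOn (continuousOn_extChartAt_symm (I := 𝓡 n) p)).isOpen_inter_preimage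
    (isOpen_extChartAt_target p) (isOpen_extChartAt_source q)

theorem chartMap_mem_target {ψ : M → M} {p q : M} {x : EuclideanSpace ℝ (Fin n)}
    (hx : x ∈ chartDomain ψ p q) : chartMap ψ p q x ∈ (extChartAt (𝓡 n) q).target :=
  (extChartAt (𝓡 n) q).map_source hx.2

theorem extChartAt_mem_chartDomain {ψ : M → M} {p q z : M}
    (hz : z ∈ (extChartAt (𝓡 n) p).source) (hψz : ψ z ∈ (extChartAt (𝓡 n) q).source) :
    extChartAt (𝓡 n) p z ∈ chartDomain ψ p q :=
  ⟨(extChartAt (𝓡 n) p).map_source hz, by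
    rwa [mem_preimage, (extChartAt (𝓡 n) p).left_inv hz]⟩

variable [IsManifold (𝓡 n) ∞ M]

/-- The trivialization of the tangent bundle given by the preferred chart at `p`. -/
noncomputable abbrev tangentTriv (p : M) : Trivialization (EuclideanSpace ℝ (Fin n))
    (TotalSpace.proj : TangentBundle (𝓡 n) M → M) :=
  trivializationAt (EuclideanSpace ℝ (Fin n)) (TangentSpace (𝓡 n)) p

/-- The expression of a metric in the preferred chart at `p`. -/
noncomputable def chartMetric (g : SemiRiemannianMetric n M) (p : M) (x : EuclideanSpace ℝ (Fin n)) :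
    EuclideanSpace ℝ (Fin n) →L[ℝ] EuclideanSpace ℝ (Fin n) →L[ℝ] ℝ :=
  let L : EuclideanSpace ℝ (Fin n) →L[ℝ] TangentSpace (𝓡 n) ((extChartAt (𝓡 n) p).symm x) :=
    (tangentTriv p).symmL ℝ ((extChartAt (𝓡 n) p).symm x)
  (L.precomp ℝ).comp ((g.val ((extChartAt (𝓡 n) p).symm x)).comp L)

theorem chartMetric_apply (g : SemiRiemannianMetric n M) (p : M)
    (x v w : EuclideanSpace ℝ (Fin n)) :
    g.chartMetric p x v w = g.val ((extChartAt (𝓡 n) p).symm x)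
      ((tangentTriv p).symmL ℝ ((extChartAt (𝓡 n) p).symm x) v)
      ((tangentTriv p).symmL ℝ ((extChartAt (𝓡 n) p).symm x) w) := rfl

theorem mem_tangentTriv_source {p : M} {w : TangentBundle (𝓡 n) M} :
    w ∈ (tangentTriv p).source ↔ w.proj ∈ (extChartAt (𝓡 n) p).source := by
  rw [extChartAt_source]; rfl

theorem tangentTriv_symm_snd (p : M) {z : M} (hz : z ∈ (extChartAt (𝓡 n) p).source)
    (v : EuclideanSpace ℝ (Fin n)) :
    (tangentTriv p ⟨z, (tangentTriv p).symmL ℝ z v⟩).2 = v := by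
  rw [extChartAt_source] at hz
  have := (tangentTriv p).continuousLinearMapAt_symmL (R := ℝ) (b := z) hz v
  rwa [(tangentTriv p).continuousLinearMapAt_apply_of_mem ℝ hz] at this

theorem symmL_tangentTriv_snd (p : M) {z : M} (hz : z ∈ (extChartAt (𝓡 n) p).source)
    (v : TangentSpace (𝓡 n) z) :
    (tangentTriv p).symmL ℝ z (tangentTriv p ⟨z, v⟩).2 = v := by
  rw [extChartAt_source] at hz
  have := (tangentTriv p).symmL_continuousLinearMapAt (R := ℝ) (b := z) hz v
  rwa [(tangentTriv p).continuousLinearMapAt_apply_of_mem ℝ hz] at this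

theorem val_eq_chartMetric (g : SemiRiemannianMetric n M) (p : M) {z : M}
    (hz : z ∈ (extChartAt (𝓡 n) p).source) (v w : TangentSpace (𝓡 n) z) :
    g.val z v w = g.chartMetric p (extChartAt (𝓡 n) p z) (tangentTriv p ⟨z, v⟩).2
      (tangentTriv p ⟨z, w⟩).2 := by
  rw [chartMetric_apply, (extChartAt (𝓡 n) p).left_inv hz, symmL_tangentTriv_snd p hz,
    symmL_tangentTriv_snd p hz]

theorem chartMetric_symm (g : SemiRiemannianMetric n M) (p : M)
    (x v w : EuclideanSpace ℝ (Fin n)) : g.chartMetric p x v w = g.chartMetric p x w v := by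
  rw [chartMetric_apply, chartMetric_apply, g.symm]

theorem chartMetric_nondegenerate (g : SemiRiemannianMetric n M) (p : M)
    {x : EuclideanSpace ℝ (Fin n)} (hx : x ∈ (extChartAt (𝓡 n) p).target)
    (v : EuclideanSpace ℝ (Fin n)) (hv : ∀ w, g.chartMetric p x v w = 0) : v = 0 := by
  have hz := (extChartAt (𝓡 n) p).map_target hx
  have h0 : (tangentTriv p).symmL ℝ ((extChartAt (𝓡 n) p).symm x) v = 0 := by
    refine g.nondegenerate _ _ fun w ↦ ?_
    rw [← hv (tangentTriv p ⟨_, w⟩).2, chartMetric_apply, symmL_tangentTriv_snd p hz]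
  have h1 := tangentTriv_symm_snd p hz 0
  rw [ContinuousLinearMap.map_zero] at h1
  rw [← tangentTriv_symm_snd p hz v, h0, h1]

theorem contDiffOn_chartMetric (g : SemiRiemannianMetric n M) (p : M) :
    ContDiffOn ℝ ∞ (g.chartMetric p) (extChartAt (𝓡 n) p).target := by
  rw [contDiffOn_clm_apply]
  intro v
  rw [contDiffOn_clm_apply]
  intro w
  rw [← contMDiffOn_iff_contDiffOn]
  have hφ : ContMDiffOn 𝓘(ℝ, EuclideanSpace ℝ (Fin n)) (𝓡 n) ∞ (extChartAt (𝓡 n) p).symm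
      (extChartAt (𝓡 n) p).target := contMDiffOn_extChartAt_symm p
  -- Vectors with constant coordinates form smooth local sections; the entries of the metric in the
  -- chart are its values on them.
  have hsec : ∀ v : EuclideanSpace ℝ (Fin n),
      ContMDiffOn 𝓘(ℝ, EuclideanSpace ℝ (Fin n)) ((𝓡 n).prod 𝓘(ℝ, EuclideanSpace ℝ (Fin n))) ∞
        (fun x ↦ TotalSpace.mk' (EuclideanSpace ℝ (Fin n)) (E := TangentSpace (𝓡 n) (M := M))
          ((extChartAt (𝓡 n) p).symm x)
          ((tangentTriv p).symmL ℝ ((extChartAt (𝓡 n) p).symm x) v))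
        (extChartAt (𝓡 n) p).target := by
    intro v
    rw [(tangentTriv p).contMDiffOn_iff (IB := 𝓡 n)
      fun x hx ↦ mem_tangentTriv_source.2 ((extChartAt (𝓡 n) p).map_target hx)]
    refine ⟨hφ, ContMDiffOn.congr (contMDiffOn_const (c := v)) fun x hx ↦ ?_⟩
    exact tangentTriv_symm_snd p ((extChartAt (𝓡 n) p).map_target hx) v
  have hg := g.contMDiff.comp_contMDiffOn hφ
  have key := ContMDiffOn.clm_bundle_apply₂ (F₃ := ℝ) (E₃ := Bundle.Trivial M ℝ) hg (hsec v) (hsec w)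
  intro x hx
  exact (contMDiffWithinAt_totalSpace.1 (key x hx)).2

theorem contDiffOn_chartMap {ψ : M → M} (hψ : ContMDiff (𝓡 n) (𝓡 n) ∞ ψ) (p q : M) :
    ContDiffOn ℝ ∞ (chartMap (n := n) ψ p q) (chartDomain ψ p q) := by
  rw [← contMDiffOn_iff_contDiffOn]
  have h1 := hψ.comp_contMDiffOn ((contMDiffOn_extChartAt_symm p).mono inter_subset_left :
    ContMDiffOn 𝓘(ℝ, EuclideanSpace ℝ (Fin n)) (𝓡 n) ∞ _ (chartDomain ψ p q))
  refine ContMDiffOn.comp (t := (chartAt (EuclideanSpace ℝ (Fin n)) q).source)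
    contMDiffOn_extChartAt h1 fun x hx ↦ ?_
  have := hx.2
  rwa [mem_preimage, extChartAt_source] at this

theorem tangentTriv_snd_eq_mfderiv {p z : M} (hz : z ∈ (extChartAt (𝓡 n) p).source)
    (v : TangentSpace (𝓡 n) z) : (tangentTriv p ⟨z, v⟩).2 =
      mfderiv (𝓡 n) 𝓘(ℝ, EuclideanSpace ℝ (Fin n)) (extChartAt (𝓡 n) p) z v := by
  rw [extChartAt_source] at hz
  have h1 := (tangentTriv p).continuousLinearMapAt_apply_of_mem ℝ hz v
  have h2 := DFunLike.congr_fun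
    (TangentBundle.continuousLinearMapAt_trivializationAt (I := 𝓡 n) hz) v
  exact h1.symm.trans h2

/-- The tangent map in the preferred charts at `p` and at `q`. -/
theorem tangentTriv_tangentMap {ψ : M → M} {p q : M} {w : TangentBundle (𝓡 n) M}
    (hψ : MDifferentiableAt (𝓡 n) (𝓡 n) ψ w.proj) (hw : w.proj ∈ (extChartAt (𝓡 n) p).source)
    (hψw : ψ w.proj ∈ (extChartAt (𝓡 n) q).source) :
    (tangentTriv q (tangentMap (𝓡 n) (𝓡 n) ψ w)).2 =
      fderiv ℝ (chartMap ψ p q) (extChartAt (𝓡 n) p w.proj) (tangentTriv p w).2 := by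
  obtain ⟨z, v⟩ := w
  dsimp only at hψ hw hψw ⊢
  have hw' := hw
  have hψw' := hψw
  rw [extChartAt_source] at hw' hψw'
  have e1 : (tangentTriv q (tangentMap (𝓡 n) (𝓡 n) ψ ⟨z, v⟩)).2 =
      mfderiv (𝓡 n) 𝓘(ℝ, EuclideanSpace ℝ (Fin n)) (extChartAt (𝓡 n) q) (ψ z)
        (mfderiv (𝓡 n) (𝓡 n) ψ z v) := tangentTriv_snd_eq_mfderiv hψw _
  have e2 := tangentTriv_snd_eq_mfderiv hw v
  have hφ := mdifferentiableAt_extChartAt (I := 𝓡 n) hw'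
  have hφq := mdifferentiableAt_extChartAt (I := 𝓡 n) hψw'
  have hx := extChartAt_mem_chartDomain hw hψw
  have hxz : (extChartAt (𝓡 n) p).symm (extChartAt (𝓡 n) p z) = z :=
    (extChartAt (𝓡 n) p).left_inv hw
  have hu : MDifferentiableAt 𝓘(ℝ, EuclideanSpace ℝ (Fin n)) 𝓘(ℝ, EuclideanSpace ℝ (Fin n))
      (chartMap ψ p q) (extChartAt (𝓡 n) p z) := by
    have h3 : MDifferentiableAt 𝓘(ℝ, EuclideanSpace ℝ (Fin n)) (𝓡 n) (extChartAt (𝓡 n) p).symm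
        (extChartAt (𝓡 n) p z) := by
      have := mdifferentiableWithinAt_extChartAt_symm (I := 𝓡 n) hx.1
      simpa [mdifferentiableWithinAt_univ] using this
    rw [← hxz] at hψ hφq
    exact MDifferentiableAt.comp _ hφq (MDifferentiableAt.comp _ hψ h3)
  -- The formula is the chain rule applied to both sides of this local identity.
  have hcomp : (chartMap ψ p q ∘ extChartAt (𝓡 n) p) =ᶠ[𝓝 z] (extChartAt (𝓡 n) q ∘ ψ) := by
    filter_upwards [extChartAt_source_mem_nhds' (I := 𝓡 n) hw] with y hy
    simp only [Function.comp_apply, chartMap]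
    rw [(extChartAt (𝓡 n) p).left_inv hy]
  have h := hcomp.mfderiv_eq (I := 𝓡 n) (I' := 𝓘(ℝ, EuclideanSpace ℝ (Fin n)))
  rw [mfderiv_comp z hu hφ, mfderiv_comp z hφq hψ, mfderiv_eq_fderiv] at h
  rw [e1, e2]
  exact (DFunLike.congr_fun h v).symm

end Charts

/-! ### Isometries in charts and bounds uniform over the isometry group. -/

section Isometries

open Metric Bundle

variable {n : ℕ} {M : Type*} [TopologicalSpace M]
  [ChartedSpace (EuclideanSpace ℝ (Fin n)) M] [IsManifold (𝓡 n) ∞ M]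

/-- Limits of tangent vectors have to be unique. Vectors over distinct points are separated by the
projection, vectors in one fibre by a trivialization. -/
instance [T2Space M] : T2Space (TangentBundle (𝓡 n) M) := by
  refine t2Space_iff_disjoint_nhds.2 fun w w' hne ↦ ?_
  by_cases h : w.proj = w'.proj
  · have hw : w ∈ (tangentTriv w.proj).source := mem_tangentTriv_source.2 (mem_extChartAt_source _)
    have hw' : w' ∈ (tangentTriv w.proj).source :=
      mem_tangentTriv_source.2 (h ▸ mem_extChartAt_source _)
    have hne' : (tangentTriv w.proj) w ≠ (tangentTriv w.proj) w' := fun h' ↦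
      hne ((tangentTriv w.proj).injOn hw hw' h')
    exact ((tangentTriv w.proj).continuousAt hw).tendsto.disjoint (disjoint_nhds_nhds.2 hne')
      ((tangentTriv w.proj).continuousAt hw').tendsto
  · exact (FiberBundle.continuous_proj _ _).continuousAt.tendsto.disjoint
      (disjoint_nhds_nhds.2 h) (FiberBundle.continuous_proj _ _).continuousAt.tendsto

theorem tendsto_tangentBundle_iff {ι : Type*} {l : Filter ι} {f : ι → TangentBundle (𝓡 n) M}
    {w : TangentBundle (𝓡 n) M} {q : M} (hq : w.proj ∈ (extChartAt (𝓡 n) q).source) :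
    Tendsto f l (𝓝 w) ↔ Tendsto (fun i ↦ (f i).proj) l (𝓝 w.proj) ∧
      Tendsto (fun i ↦ (tangentTriv q (f i)).2) l (𝓝 (tangentTriv q w).2) :=
  (tangentTriv q).tendsto_nhds_iff (mem_tangentTriv_source.2 hq)

/-- The expression in charts of a smooth map preserving the metric preserves the expressions in
charts of the metric. -/
theorem chartMetric_fderiv_chartMap (g : SemiRiemannianMetric n M) {ψ : M → M}
    (hψ : MDifferentiable (𝓡 n) (𝓡 n) ψ)
    (hiso : ∀ (z : M) (v w : TangentSpace (𝓡 n) z),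
      g.val (ψ z) (mfderiv (𝓡 n) (𝓡 n) ψ z v) (mfderiv (𝓡 n) (𝓡 n) ψ z w) = g.val z v w)
    {p q : M} {x : EuclideanSpace ℝ (Fin n)} (hx : x ∈ chartDomain ψ p q)
    (v w : EuclideanSpace ℝ (Fin n)) :
    g.chartMetric q (chartMap ψ p q x) (fderiv ℝ (chartMap ψ p q) x v)
      (fderiv ℝ (chartMap ψ p q) x w) = g.chartMetric p x v w := by
  obtain ⟨z, hz, rfl⟩ : ∃ z ∈ (extChartAt (𝓡 n) p).source, extChartAt (𝓡 n) p z = x :=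
    ⟨_, (extChartAt (𝓡 n) p).map_target hx.1, (extChartAt (𝓡 n) p).right_inv hx.1⟩
  have hψz : ψ z ∈ (extChartAt (𝓡 n) q).source := by
    have := hx.2
    rwa [mem_preimage, (extChartAt (𝓡 n) p).left_inv hz] at this
  have hu : chartMap ψ p q (extChartAt (𝓡 n) p z) = extChartAt (𝓡 n) q (ψ z) := by
    rw [chartMap, (extChartAt (𝓡 n) p).left_inv hz]
  have key := fun v : EuclideanSpace ℝ (Fin n) ↦ tangentTriv_tangentMap (p := p) (q := q)
    (w := ⟨z, (tangentTriv p).symmL ℝ z v⟩) (hψ z) hz hψz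
  simp only [tangentTriv_symm_snd p hz] at key
  rw [← key v, ← key w, hu]
  have h := hiso z ((tangentTriv p).symmL ℝ z v) ((tangentTriv p).symmL ℝ z w)
  rw [val_eq_chartMetric g q hψz, val_eq_chartMetric g p hz, tangentTriv_symm_snd p hz,
    tangentTriv_symm_snd p hz] at h
  exact h

/-- The Christoffel symbols of a metric in the preferred chart at `p`. -/
noncomputable abbrev chartChristoffel (g : SemiRiemannianMetric n M) (p : M) :=
  christoffel (g.chartMetric p)

theorem contDiffOn_chartChristoffel (g : SemiRiemannianMetric n M) (p : M) :
    ContDiffOn ℝ ∞ (g.chartChristoffel p) (extChartAt (𝓡 n) p).target :=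
  contDiffOn_christoffel (isOpen_extChartAt_target p) (g.contDiffOn_chartMetric p)
    fun _ hx ↦ g.chartMetric_nondegenerate p hx

variable {g : SemiRiemannianMetric n M}

theorem contMDiff_isometry (ψ : g.isometryGroup) : ContMDiff (𝓡 n) (𝓡 n) ∞ ψ.1 := ψ.2.1

theorem mdifferentiable_isometry (ψ : g.isometryGroup) : MDifferentiable (𝓡 n) (𝓡 n) ψ.1 :=
  ψ.2.1.mdifferentiable (by simp)

theorem contDiffOn_two_chartMap (ψ : g.isometryGroup) (p q : M) :
    ContDiffOn ℝ 2 (chartMap (n := n) ψ.1 p q) (chartDomain ψ.1 p q) := by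
  exact_mod_cast contDiffOn_infty.1 (contDiffOn_chartMap ψ.2.1 p q) 2

/-- The Hessian in charts of an isometry. -/
theorem fderiv_fderiv_chartMap (ψ : g.isometryGroup) {p q : M} {x : EuclideanSpace ℝ (Fin n)}
    (hx : x ∈ chartDomain ψ.1 p q) :
    fderiv ℝ (fderiv ℝ (chartMap ψ.1 p q)) x =
      affineHessian (g.chartChristoffel p) (g.chartChristoffel q)
        (x, chartMap ψ.1 p q x, fderiv ℝ (chartMap ψ.1 p q) x) := by
  have hux := chartMap_mem_target hx
  refine fderiv_fderiv_eq_affineHessian (isOpen_chartDomain ψ.1.continuous p q)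
    (contDiffOn_two_chartMap ψ p q)
    (fun x hx v w ↦ g.chartMetric_fderiv_chartMap (mdifferentiable_isometry ψ) ψ.2.2.2 hx v w) hx
    ?_ ?_ (g.chartMetric_nondegenerate p hx.1) (g.chartMetric_nondegenerate q hux)
    (g.chartMetric_symm q _)
  · exact ((g.contDiffOn_chartMetric p).differentiableOn (by simp)).differentiableAt
      ((isOpen_extChartAt_target p).mem_nhds hx.1)
  · exact ((g.contDiffOn_chartMetric q).differentiableOn (by simp)).differentiableAt
      ((isOpen_extChartAt_target q).mem_nhds hux)

-- The preimage of `K` under the chart at `q` is compact, hence closed in M, so values of ψ trapped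
-- in it stay in the chart domain in the limit. This supplies the hypothesis `hcl` of
-- `norm_fderiv_lt_of_hessian_le`.
omit [IsManifold (𝓡 n) ∞ M] in
theorem mem_chartDomain_of_mem_closure [T2Space M] {ψ : M → M} (hψ : Continuous ψ) {p q : M}
    {K : Set (EuclideanSpace ℝ (Fin n))} (hK : IsCompact K) (hKq : K ⊆ (extChartAt (𝓡 n) q).target)
    {x : EuclideanSpace ℝ (Fin n)} (hx : x ∈ (extChartAt (𝓡 n) p).target)
    (hcl : x ∈ closure (chartDomain ψ p q ∩ chartMap ψ p q ⁻¹' K)) : x ∈ chartDomain ψ p q := by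
  have hK' : IsCompact ((extChartAt (𝓡 n) q).symm '' K) :=
    hK.image_of_continuousOn ((continuousOn_extChartAt_symm q).mono hKq)
  have hc : ContinuousAt (fun x ↦ ψ ((extChartAt (𝓡 n) p).symm x)) x :=
    hψ.continuousAt.comp ((continuousOn_extChartAt_symm p).continuousAt
      ((isOpen_extChartAt_target p).mem_nhds hx))
  have h := hc.continuousWithinAt.mem_closure hcl (t := (extChartAt (𝓡 n) q).symm '' K)
    fun y hy ↦ ⟨_, hy.2, (extChartAt (𝓡 n) q).left_inv hy.1.2⟩
  rw [hK'.isClosed.closure_eq] at h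
  obtain ⟨y, hy, hyx⟩ := h
  refine ⟨hx, ?_⟩
  rw [mem_preimage, ← hyx]
  exact (extChartAt (𝓡 n) q).map_target (hKq hy)

/-- Uniform local bounds on isometries in charts: a bound on the first derivative at a point gives
bounds on the first two derivatives on a ball of controlled radius. -/
theorem exists_uniform_chart_bound [T2Space M] (g : SemiRiemannianMetric n M) (p q : M) :
    ∃ ρ > 0, ∃ c > 0, ∃ C ≥ 0,
      closedBall (extChartAt (𝓡 n) p p) (2 * ρ) ⊆ (extChartAt (𝓡 n) p).target ∧
      closedBall (extChartAt (𝓡 n) q q) (2 * ρ) ⊆ (extChartAt (𝓡 n) q).target ∧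
      ∀ (ψ : g.isometryGroup) (Λ : ℝ), 1 ≤ Λ → ∀ x ∈ ball (extChartAt (𝓡 n) p p) ρ,
        x ∈ chartDomain ψ.1 p q → chartMap ψ.1 p q x ∈ ball (extChartAt (𝓡 n) q q) ρ →
        ‖fderiv ℝ (chartMap ψ.1 p q) x‖ ≤ Λ → ∀ x' ∈ ball x (c / Λ),
          x' ∈ chartDomain ψ.1 p q ∧
          chartMap ψ.1 p q x' ∈ ball (extChartAt (𝓡 n) q q) (2 * ρ) ∧
          ‖fderiv ℝ (chartMap ψ.1 p q) x'‖ ≤ 2 * Λ ∧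
          ‖fderiv ℝ (fderiv ℝ (chartMap ψ.1 p q)) x'‖ ≤ C * Λ ^ 2 := by
  have hball : ∀ p : M, ∃ ε > 0,
      closedBall (extChartAt (𝓡 n) p p) ε ⊆ (extChartAt (𝓡 n) p).target := fun p ↦
    Metric.nhds_basis_closedBall.mem_iff.1 (extChartAt_target_mem_nhds p)
  obtain ⟨εp, hεp, hp⟩ := hball p
  obtain ⟨εq, hεq, hq⟩ := hball q
  set ρ := min εp εq / 2 with hρ
  have hρ0 : 0 < ρ := by positivity
  have h2ρ : 2 * ρ = min εp εq := by rw [hρ]; ring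
  have hp' : closedBall (extChartAt (𝓡 n) p p) (2 * ρ) ⊆ (extChartAt (𝓡 n) p).target :=
    (closedBall_subset_closedBall (h2ρ ▸ min_le_left _ _)).trans hp
  have hq' : closedBall (extChartAt (𝓡 n) q q) (2 * ρ) ⊆ (extChartAt (𝓡 n) q).target :=
    (closedBall_subset_closedBall (h2ρ ▸ min_le_right _ _)).trans hq
  obtain ⟨Cp, hCp⟩ := (isCompact_closedBall (extChartAt (𝓡 n) p p) (2 * ρ)).exists_bound_of_continuousOn
    ((g.contDiffOn_chartChristoffel p).continuousOn.mono hp')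
  obtain ⟨Cq, hCq⟩ := (isCompact_closedBall (extChartAt (𝓡 n) q q) (2 * ρ)).exists_bound_of_continuousOn
    ((g.contDiffOn_chartChristoffel q).continuousOn.mono hq')
  set C := max 0 (max Cp Cq) with hC
  have hC0 : 0 ≤ C := le_max_left _ _
  -- For r = c/Λ the conditions 2Λr ≤ ρ and 12CΛr ≤ 1 become 2c ≤ ρ and 12Cc ≤ 1, free of Λ. Since
  -- `C` only bounds the Christoffel symbols on two compact balls, no constant depends on the
  -- isometry.
  set c := min (ρ / 2) (1 / (12 * C + 1)) with hc
  have hc0 : 0 < c := by positivity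
  have hc1 : 2 * c ≤ ρ := by linarith [min_le_left (ρ / 2) (1 / (12 * C + 1))]
  have hc2 : 12 * C * c ≤ 1 := by
    calc 12 * C * c ≤ (12 * C + 1) * (1 / (12 * C + 1)) := by
          gcongr
          · linarith
          · exact min_le_right _ _
      _ = 1 := by field_simp
  refine ⟨ρ, hρ0, c, hc0, 6 * C, by positivity, hp', hq', ?_⟩
  intro ψ Λ hΛ x hxρ hxd hux hDx
  have hΛ0 : 0 < Λ := by linarith
  have hcΛ : Λ * (c / Λ) = c := by field_simp
  have hcle : c / Λ ≤ c := div_le_self hc0.le hΛ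
  have hsub : ball x (c / Λ) ⊆ closedBall (extChartAt (𝓡 n) p p) (2 * ρ) := by
    refine (ball_subset_ball' ?_).trans ball_subset_closedBall
    have := mem_ball.1 hxρ
    linarith
  have hess : ∀ x' ∈ chartDomain ψ.1 p q, x' ∈ ball x (c / Λ) →
      chartMap ψ.1 p q x' ∈ closedBall (extChartAt (𝓡 n) q q) (2 * ρ) →
      ‖fderiv ℝ (fderiv ℝ (chartMap ψ.1 p q)) x'‖ ≤
        C * (‖fderiv ℝ (chartMap ψ.1 p q) x'‖ + ‖fderiv ℝ (chartMap ψ.1 p q) x'‖ ^ 2) := by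
    intro x' hx' hx'b hux'
    rw [fderiv_fderiv_chartMap ψ hx']
    exact norm_affineHessian_le _ _ _ _ _
      ((hCp _ (hsub hx'b)).trans ((le_max_left _ _).trans (le_max_right _ _)))
      ((hCq _ hux').trans ((le_max_right _ _).trans (le_max_right _ _)))
  have key := norm_fderiv_lt_of_hessian_le (isOpen_chartDomain ψ.1.continuous p q)
    (contDiffOn_two_chartMap ψ p q) hC0 hΛ
    (div_pos hc0 hΛ0) (by rw [mul_assoc, hcΛ]; exact hc1) (by rw [mul_assoc, hcΛ]; exact hc2) hess
    (fun x' hx' hcl ↦ mem_chartDomain_of_mem_closure ψ.1.continuous (isCompact_closedBall _ _) hq'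
      (hp' (hsub hx')) hcl) hxd hux hDx
  intro x' hx'
  obtain ⟨h1, h2, h3⟩ := key x' hx'
  refine ⟨h1, h2, h3.le, (hess x' h1 hx' (ball_subset_closedBall h2)).trans ?_⟩
  calc C * (‖fderiv ℝ (chartMap ψ.1 p q) x'‖ + ‖fderiv ℝ (chartMap ψ.1 p q) x'‖ ^ 2)
      ≤ C * (2 * Λ + (2 * Λ) ^ 2) := by gcongr
    _ ≤ C * (6 * Λ ^ 2) := by gcongr; nlinarith
    _ = 6 * C * Λ ^ 2 := by ring

/-- The tangent map of an isometry. -/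
noncomputable def tmap (ψ : g.isometryGroup) : TangentBundle (𝓡 n) M → TangentBundle (𝓡 n) M :=
  tangentMap (𝓡 n) (𝓡 n) ψ.1

theorem continuous_tmap (ψ : g.isometryGroup) : Continuous (tmap ψ) :=
  (contMDiff_isometry ψ).continuous_tangentMap (by simp)

theorem tmap_one : tmap (1 : g.isometryGroup) = id := tangentMap_id

theorem tmap_mul (ψ φ : g.isometryGroup) (w : TangentBundle (𝓡 n) M) :
    tmap (ψ * φ) w = tmap ψ (tmap φ w) :=
  congrFun (tangentMap_comp (I := 𝓡 n) (I' := 𝓡 n) (I'' := 𝓡 n) (mdifferentiable_isometry ψ)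
    (mdifferentiable_isometry φ)) w

theorem tmap_inv_tmap (ψ : g.isometryGroup) (w : TangentBundle (𝓡 n) M) :
    tmap ψ⁻¹ (tmap ψ w) = w := by
  rw [← tmap_mul, inv_mul_cancel, tmap_one, id]

theorem tmap_tmap_inv (ψ : g.isometryGroup) (w : TangentBundle (𝓡 n) M) :
    tmap ψ (tmap ψ⁻¹ w) = w := by
  rw [← tmap_mul, mul_inv_cancel, tmap_one, id]

theorem tangentTriv_tmap (ψ : g.isometryGroup) {p q : M} {w : TangentBundle (𝓡 n) M}
    (hw : w.proj ∈ (extChartAt (𝓡 n) p).source) (hψw : ψ.1 w.proj ∈ (extChartAt (𝓡 n) q).source) :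
    (tangentTriv q (tmap ψ w)).2 =
      fderiv ℝ (chartMap ψ.1 p q) (extChartAt (𝓡 n) p w.proj) (tangentTriv p w).2 :=
  tangentTriv_tangentMap (mdifferentiable_isometry ψ _) hw hψw

end Isometries

/-! ### An isometry is determined by its 1-jet at one point. -/

section Rigidity

open Metric Bundle

variable {n : ℕ} {M : Type*} [TopologicalSpace M]
  [ChartedSpace (EuclideanSpace ℝ (Fin n)) M] [IsManifold (𝓡 n) ∞ M]

/-- The tangent vector at `z` with coordinates `v` in the preferred chart at `p`. -/
noncomputable def coordVec (p z : M) (v : EuclideanSpace ℝ (Fin n)) : TangentBundle (𝓡 n) M :=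
  ⟨z, (tangentTriv p).symmL ℝ z v⟩

theorem coordVec_proj (p z : M) (v : EuclideanSpace ℝ (Fin n)) : (coordVec p z v).proj = z := rfl

theorem tangentTriv_coordVec {p z : M} (hz : z ∈ (extChartAt (𝓡 n) p).source)
    (v : EuclideanSpace ℝ (Fin n)) : (tangentTriv p (coordVec p z v)).2 = v :=
  tangentTriv_symm_snd p hz v

theorem coordVec_tangentTriv {p : M} {w : TangentBundle (𝓡 n) M}
    (hw : w.proj ∈ (extChartAt (𝓡 n) p).source) :
    coordVec p w.proj (tangentTriv p w).2 = w := by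
  obtain ⟨z, v⟩ := w
  exact congrArg (TotalSpace.mk z) (symmL_tangentTriv_snd p hw v)

theorem tendsto_coordVec {p z : M} (hz : z ∈ (extChartAt (𝓡 n) p).source)
    (v : EuclideanSpace ℝ (Fin n)) :
    Tendsto (fun z' ↦ coordVec p z' v) (𝓝 z) (𝓝 (coordVec p z v)) := by
  rw [tendsto_tangentBundle_iff (q := p) hz, tangentTriv_coordVec hz]
  refine ⟨tendsto_id, tendsto_const_nhds.congr' ?_⟩
  filter_upwards [(isOpen_extChartAt_source (I := 𝓡 n) p).mem_nhds hz] with z' hz'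
  exact (tangentTriv_coordVec hz' v).symm

theorem tangentBundle_ext {q : M} {w w' : TangentBundle (𝓡 n) M} (h : w.proj = w'.proj)
    (hq : w.proj ∈ (extChartAt (𝓡 n) q).source)
    (h' : (tangentTriv q w).2 = (tangentTriv q w').2) : w = w' := by
  rw [← coordVec_tangentTriv hq, ← coordVec_tangentTriv (w := w') (h ▸ hq), h', h]

variable {g : SemiRiemannianMetric n M}

theorem tangentTriv_tmap_coordVec (ψ : g.isometryGroup) {p q z : M}
    (hz : z ∈ (extChartAt (𝓡 n) p).source) (hψz : ψ.1 z ∈ (extChartAt (𝓡 n) q).source)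
    (v : EuclideanSpace ℝ (Fin n)) : (tangentTriv q (tmap ψ (coordVec p z v))).2 =
      fderiv ℝ (chartMap ψ.1 p q) (extChartAt (𝓡 n) p z) v := by
  rw [tangentTriv_tmap ψ (w := coordVec p z v) hz hψz, coordVec_proj, tangentTriv_coordVec hz]

omit [IsManifold (𝓡 n) ∞ M] in
theorem chartMap_extChartAt (ψ : M → M) {p q z : M} (hz : z ∈ (extChartAt (𝓡 n) p).source) :
    chartMap ψ p q (extChartAt (𝓡 n) p z) = extChartAt (𝓡 n) q (ψ z) := by
  rw [chartMap, (extChartAt (𝓡 n) p).left_inv hz]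

/-- The openness half of rigidity. As ψ p = φ p, one target chart serves both maps, and their chart
expressions solve the same second order system with the same initial jet. -/
theorem eventually_tmap_eq (ψ φ : g.isometryGroup) {p : M}
    (h : ∀ w : TangentBundle (𝓡 n) M, w.proj = p → tmap ψ w = tmap φ w) :
    ∀ᶠ z in 𝓝 p, ∀ w : TangentBundle (𝓡 n) M, w.proj = z → tmap ψ w = tmap φ w := by
  have hp := mem_extChartAt_source (I := 𝓡 n) p
  have hpt : ψ.1 p = φ.1 p := congrArg TotalSpace.proj (h (coordVec p p 0) rfl)
  obtain ⟨q, hφq, hψq⟩ : ∃ q, φ.1 p ∈ (extChartAt (𝓡 n) q).source ∧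
      ψ.1 p ∈ (extChartAt (𝓡 n) q).source :=
    ⟨φ.1 p, mem_extChartAt_source _, hpt.symm ▸ mem_extChartAt_source _⟩
  have hψd := extChartAt_mem_chartDomain hp hψq
  have hφd := extChartAt_mem_chartDomain hp hφq
  have hψo : chartDomain (n := n) ψ.1 p q ∈ 𝓝 (extChartAt (𝓡 n) p p) :=
    (isOpen_chartDomain ψ.1.continuous p q).mem_nhds hψd
  have hφo : chartDomain (n := n) φ.1 p q ∈ 𝓝 (extChartAt (𝓡 n) p p) :=
    (isOpen_chartDomain φ.1.continuous p q).mem_nhds hφd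
  have hF : ContDiffAt ℝ 1 (affineHessian (g.chartChristoffel p) (g.chartChristoffel q))
      (extChartAt (𝓡 n) p p, chartMap ψ.1 p q (extChartAt (𝓡 n) p p),
        fderiv ℝ (chartMap ψ.1 p q) (extChartAt (𝓡 n) p p)) := by
    have := contDiffOn_affineHessian (g.contDiffOn_chartChristoffel p)
      (g.contDiffOn_chartChristoffel q)
    refine (ContDiffOn.contDiffAt (contDiffOn_infty.1 this 1) ?_)
    exact prod_mem_nhds ((isOpen_extChartAt_target p).mem_nhds hψd.1)
      (prod_mem_nhds ((isOpen_extChartAt_target q).mem_nhds (chartMap_mem_target hψd)) univ_mem)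
  have hev : chartMap ψ.1 p q =ᶠ[𝓝 (extChartAt (𝓡 n) p p)] chartMap φ.1 p q := by
    refine eventuallyEq_of_jet_eq (inter_mem hψo hφo)
      ((contDiffOn_two_chartMap ψ p q).mono inter_subset_left)
      ((contDiffOn_two_chartMap φ p q).mono inter_subset_right) hF
      (fun x hx ↦ fderiv_fderiv_chartMap ψ hx.1) (fun x hx ↦ fderiv_fderiv_chartMap φ hx.2) ?_ ?_
    · rw [chartMap_extChartAt _ hp, chartMap_extChartAt _ hp, hpt]
    · ext1 v
      rw [← tangentTriv_tmap_coordVec ψ hp hψq, ← tangentTriv_tmap_coordVec φ hp hφq,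
        h (coordVec p p v) rfl]
  have hc : ContinuousAt (extChartAt (𝓡 n) p) p := continuousAt_extChartAt p
  filter_upwards [hc.eventually hev, hc.eventually (hev.fderiv (𝕜 := ℝ)), hc.preimage_mem_nhds hψo,
    hc.preimage_mem_nhds hφo, (isOpen_extChartAt_source (I := 𝓡 n) p).mem_nhds hp] with
    z h1 h2 h3 h4 hz w hw
  subst hw
  have hψz : ψ.1 w.proj ∈ (extChartAt (𝓡 n) q).source := by
    have := h3.2
    rwa [mem_preimage, (extChartAt (𝓡 n) p).left_inv hz] at this
  have hφz : φ.1 w.proj ∈ (extChartAt (𝓡 n) q).source := by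
    have := h4.2
    rwa [mem_preimage, (extChartAt (𝓡 n) p).left_inv hz] at this
  refine tangentBundle_ext (q := q) ?_ hψz ?_
  · rw [chartMap_extChartAt _ hz, chartMap_extChartAt _ hz] at h1
    exact (extChartAt (𝓡 n) q).injOn hψz hφz h1
  · rw [tangentTriv_tmap ψ hz hψz, tangentTriv_tmap φ hz hφz, h2]

/-- Two isometries of a connected manifold that agree to first order at a point are equal. -/
theorem eq_of_tmap_eq [T2Space M] [ConnectedSpace M] (ψ φ : g.isometryGroup) {p : M}
    (h : ∀ w : TangentBundle (𝓡 n) M, w.proj = p → tmap ψ w = tmap φ w) : ψ = φ := by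
  set S : Set M := {z | ∀ w : TangentBundle (𝓡 n) M, w.proj = z → tmap ψ w = tmap φ w} with hS
  have hopen : IsOpen S := isOpen_iff_mem_nhds.2 fun z hz ↦ eventually_tmap_eq ψ φ hz
  have hclosed : IsClosed S := by
    refine isClosed_of_closure_subset fun z hz w hw ↦ ?_
    subst hw
    have : (𝓝[S] w.proj).NeBot := mem_closure_iff_nhdsWithin_neBot.1 hz
    have hs := mem_extChartAt_source (I := 𝓡 n) w.proj
    -- Extending `w` with constant coordinates approximates it by vectors over `S`, where the two
    -- tangent maps agree.
    have hlim : Tendsto (fun z' ↦ coordVec w.proj z' (tangentTriv w.proj w).2) (𝓝[S] w.proj)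
        (𝓝 w) := by
      have := (tendsto_coordVec hs (tangentTriv w.proj w).2).mono_left
        (nhdsWithin_le_nhds (s := S))
      rwa [coordVec_tangentTriv hs] at this
    refine tendsto_nhds_unique (((continuous_tmap ψ).tendsto w).comp hlim)
      ((((continuous_tmap φ).tendsto w).comp hlim).congr' ?_)
    filter_upwards [self_mem_nhdsWithin] with z' hz'
    exact (hz' _ rfl).symm
  have huniv : S = univ := IsClopen.eq_univ ⟨hclosed, hopen⟩ ⟨p, h⟩
  refine Subtype.ext (Homeomorph.ext fun z ↦ ?_)
  have hz : z ∈ S := huniv ▸ mem_univ z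
  exact congrArg TotalSpace.proj (hz (coordVec z z 0) rfl)

/-- The differential fixes a basis of the tangent space, so ψ has the 1-jet of the identity at the
base point. -/
theorem eq_one_of_smul_eq [T2Space M] [ConnectedSpace M] {k l : ℕ} (ψ : g.isometryGroup)
    (F : OrthonormalFrame g k l) (h : ψ • F = F) : ψ = 1 := by
  have h1 : (ψ • F).toProd = F.toProd := congrArg _ h
  rw [OrthonormalFrame.toProd_smul] at h1
  have hpt : ψ.1 F.point = F.point := congrArg Prod.fst h1
  have hb : ∀ i, tmap ψ ⟨F.point, F.basis i⟩ = ⟨F.point, F.basis i⟩ := fun i ↦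
    congrFun (congrArg Prod.snd h1) i
  refine eq_of_tmap_eq ψ 1 (p := F.point) fun w hw ↦ ?_
  rw [tmap_one, id]
  obtain ⟨z, v⟩ := w
  obtain rfl : z = F.point := hw
  have hs := mem_extChartAt_source (I := 𝓡 n) F.point
  have hψs : ψ.1 F.point ∈ (extChartAt (𝓡 n) F.point).source := by rwa [hpt]
  refine tangentBundle_ext (q := F.point) hpt hψs ?_
  rw [tangentTriv_tmap ψ (p := F.point) hs hψs]
  have hs' := hs
  rw [extChartAt_source] at hs'
  let A := fderiv ℝ (chartMap ψ.1 F.point F.point) (extChartAt (𝓡 n) F.point F.point)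
  let L : TangentSpace (𝓡 n) F.point →L[ℝ] EuclideanSpace ℝ (Fin n) :=
    (tangentTriv F.point).continuousLinearMapAt ℝ F.point
  have hL : ∀ v, L v = (tangentTriv F.point ⟨F.point, v⟩).2 :=
    (tangentTriv F.point).continuousLinearMapAt_apply_of_mem ℝ hs'
  have key : (A ∘L L).toLinearMap = L.toLinearMap := by
    refine F.basis.ext fun i ↦ ?_
    have := tangentTriv_tmap ψ (p := F.point) (q := F.point) (w := ⟨F.point, F.basis i⟩) hs hψs
    rw [hb] at this
    exact (congrArg A (hL _)).trans (this.symm.trans (hL _).symm)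
  have := DFunLike.congr_fun key v
  rw [← hL v]
  exact this

end Rigidity

/-! ### Pointwise convergence of operators on finite-dimensional spaces. -/

section FiniteDimensional

variable {E F : Type*} [NormedAddCommGroup E] [NormedSpace ℝ E] [FiniteDimensional ℝ E]
  [NormedAddCommGroup F] [NormedSpace ℝ F] [FiniteDimensional ℝ F]

/-- Operators on a finite-dimensional space that converge pointwise on a basis converge. -/
theorem tendsto_clm_of_basis {ι κ : Type*} [Finite κ] {l : Filter ι} {f : ι → E →L[ℝ] F}
    (b : Module.Basis κ ℝ E) {A : E →L[ℝ] F} (h : ∀ j, Tendsto (fun i ↦ f i (b j)) l (𝓝 (A (b j)))) :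
    Tendsto f l (𝓝 A) := by
  have := Fintype.ofFinite κ
  let G : (κ → F) →ₗ[ℝ] (E →L[ℝ] F) :=
    (LinearMap.toContinuousLinearMap : (E →ₗ[ℝ] F) ≃ₗ[ℝ] (E →L[ℝ] F)).toLinearMap ∘ₗ
      (b.constr ℝ).toLinearMap
  have hG : ∀ B : E →L[ℝ] F, G (fun j ↦ B (b j)) = B := fun B ↦ by
    ext v
    change b.constr ℝ (fun j ↦ B.toLinearMap (b j)) v = B.toLinearMap v
    rw [b.constr_self]
  have h1 : Tendsto (fun i j ↦ f i (b j)) l (𝓝 fun j ↦ A (b j)) := tendsto_pi_nhds.2 h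
  have h2 := (G.continuous_of_finiteDimensional.tendsto _).comp h1
  simpa only [Function.comp_def, hG] using h2

theorem tendsto_clm_of_apply {ι : Type*} {l : Filter ι} {f : ι → E →L[ℝ] F} {A : E →L[ℝ] F}
    (h : ∀ v, Tendsto (fun i ↦ f i v) l (𝓝 (A v))) : Tendsto f l (𝓝 A) :=
  tendsto_clm_of_basis (Module.finBasis ℝ E) fun _ ↦ h _

theorem exists_tendsto_clm {ι : Type*} {l : Filter ι} {f : ι → E →L[ℝ] F}
    (h : ∀ v, ∃ y, Tendsto (fun i ↦ f i v) l (𝓝 y)) : ∃ A : E →L[ℝ] F, Tendsto f l (𝓝 A) := by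
  choose y hy using h
  let b := Module.finBasis ℝ E
  refine ⟨LinearMap.toContinuousLinearMap (b.constr ℝ fun j ↦ y (b j)),
    tendsto_clm_of_basis b fun j ↦ ?_⟩
  simpa using hy (b j)

end FiniteDimensional

/-! ### Compact-open convergence implies convergence of derivatives; the action is continuous. -/

section Continuity

open Metric Bundle

variable {n : ℕ} {M : Type*} [TopologicalSpace M]
  [ChartedSpace (EuclideanSpace ℝ (Fin n)) M] [IsManifold (𝓡 n) ∞ M]
  {g : SemiRiemannianMetric n M}

/-- M is locally compact, so evaluation is jointly continuous for the compact-open topology. -/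
theorem continuous_isometry_apply [T2Space M] :
    Continuous fun a : g.isometryGroup × M ↦ a.1.1 a.2 := by
  have := ChartedSpace.locallyCompactSpace (EuclideanSpace ℝ (Fin n)) M
  have h1 : Continuous fun ψ : g.isometryGroup ↦ (⟨ψ.1, ψ.1.continuous⟩ : C(M, M)) :=
    continuous_induced_dom
  exact ContinuousEval.continuous_eval.comp (h1.prodMap continuous_id)

theorem eventually_mem_chartDomain [T2Space M] {ψ : g.isometryGroup} {p q : M}
    {x : EuclideanSpace ℝ (Fin n)} (hx : x ∈ chartDomain ψ.1 p q) :
    ∀ᶠ a : g.isometryGroup × EuclideanSpace ℝ (Fin n) in 𝓝 (ψ, x), a.2 ∈ chartDomain a.1.1 p q := by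
  have hc : ContinuousAt (fun a : g.isometryGroup × EuclideanSpace ℝ (Fin n) ↦
      a.1.1 ((extChartAt (𝓡 n) p).symm a.2)) (ψ, x) := by
    refine continuous_isometry_apply.continuousAt.comp (f := fun a : g.isometryGroup ×
      EuclideanSpace ℝ (Fin n) ↦ (a.1, (extChartAt (𝓡 n) p).symm a.2))
      (continuousAt_fst.prodMk (ContinuousAt.comp ?_ continuousAt_snd))
    exact (continuousOn_extChartAt_symm p).continuousAt ((isOpen_extChartAt_target p).mem_nhds hx.1)
  filter_upwards [hc.preimage_mem_nhds ((isOpen_extChartAt_source q).mem_nhds hx.2),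
    continuousAt_snd.preimage_mem_nhds ((isOpen_extChartAt_target p).mem_nhds hx.1)] with a h1 h2
  exact ⟨h2, h1⟩

theorem continuousAt_chartMap [T2Space M] {ψ : g.isometryGroup} {p q : M}
    {x : EuclideanSpace ℝ (Fin n)} (hx : x ∈ chartDomain ψ.1 p q) :
    ContinuousAt (fun a : g.isometryGroup × EuclideanSpace ℝ (Fin n) ↦ chartMap a.1.1 p q a.2)
      (ψ, x) := by
  have hc : ContinuousAt (fun a : g.isometryGroup × EuclideanSpace ℝ (Fin n) ↦
      a.1.1 ((extChartAt (𝓡 n) p).symm a.2)) (ψ, x) := by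
    refine continuous_isometry_apply.continuousAt.comp (f := fun a : g.isometryGroup ×
      EuclideanSpace ℝ (Fin n) ↦ (a.1, (extChartAt (𝓡 n) p).symm a.2))
      (continuousAt_fst.prodMk (ContinuousAt.comp ?_ continuousAt_snd))
    exact (continuousOn_extChartAt_symm p).continuousAt ((isOpen_extChartAt_target p).mem_nhds hx.1)
  have hq : ContinuousAt (extChartAt (𝓡 n) q) (ψ.1 ((extChartAt (𝓡 n) p).symm x)) :=
    (continuousOn_extChartAt q).continuousAt ((isOpen_extChartAt_source q).mem_nhds hx.2)
  exact ContinuousAt.comp (f := fun a : g.isometryGroup × EuclideanSpace ℝ (Fin n) ↦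
    a.1.1 ((extChartAt (𝓡 n) p).symm a.2)) hq hc

/-- The second derivatives in charts of isometries are bounded, locally uniformly for the
compact-open topology. -/
theorem exists_eventually_hessian_bound [T2Space M] (ψ : g.isometryGroup) (p : M) :
    ∃ r > 0, ∃ C ≥ 0, ∀ᶠ a : g.isometryGroup × EuclideanSpace ℝ (Fin n) in
      𝓝 (ψ, extChartAt (𝓡 n) p p), ∀ x ∈ ball a.2 r, x ∈ chartDomain a.1.1 p (ψ.1 p) ∧
        ‖fderiv ℝ (fderiv ℝ (chartMap a.1.1 p (ψ.1 p))) x‖ ≤ C := by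
  set q := ψ.1 p with hq
  set a₀ := extChartAt (𝓡 n) p p with ha₀
  obtain ⟨ρ, hρ, c, hc, C, hC, hpt, hqt, key⟩ := exists_uniform_chart_bound g p q
  -- A displacement c'/Λ stays in the ball of radius c/Λ, where the Hessian is at most CΛ², and the
  -- Taylor remainder CΛ²(c'/Λ)² = Cc'² is then at most c'/4.
  set c' := min (c / 2) (1 / (4 * (C + 1))) with hc'
  have hc'0 : 0 < c' := by positivity
  have hc'c : c' < c := (min_le_left _ _).trans_lt (by linarith)
  have hCc' : C * c' ≤ 1 / 4 := by
    calc C * c' ≤ C * (1 / (4 * (C + 1))) := by gcongr; exact min_le_right _ _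
      _ ≤ 1 / 4 := by
        rw [mul_one_div, div_le_div_iff₀ (by positivity) (by positivity)]
        linarith
  have hd : a₀ ∈ chartDomain ψ.1 p q :=
    extChartAt_mem_chartDomain (mem_extChartAt_source p) (mem_extChartAt_source q)
  have hval : chartMap ψ.1 p q a₀ = extChartAt (𝓡 n) q q :=
    chartMap_extChartAt _ (mem_extChartAt_source p)
  have hnear : ∀ᶠ a : g.isometryGroup × EuclideanSpace ℝ (Fin n) in 𝓝 (ψ, a₀),
      a.2 ∈ chartDomain a.1.1 p q ∧
      chartMap a.1.1 p q a.2 ∈ ball (extChartAt (𝓡 n) q q) (min ρ (c' / 8)) ∧ a.2 ∈ ball a₀ ρ := by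
    refine (eventually_mem_chartDomain hd).and ((continuousAt_chartMap hd).eventually ?_ |>.and ?_)
    · dsimp only
      rw [hval]
      exact ball_mem_nhds _ (by positivity)
    · exact continuousAt_snd.eventually (ball_mem_nhds _ hρ)
  rw [nhds_prod_eq, eventually_prod_iff] at hnear
  obtain ⟨P, hP, Q, hQ, hPQ⟩ := hnear
  obtain ⟨η', hη', hηQ⟩ := Metric.eventually_nhds_iff_ball.1 hQ
  set η := η' / 2 with hη
  have hη0 : 0 < η := by positivity
  -- If Λ > Λ₀ then c'/Λ < η, so the displaced point remains in the η'-ball where values lie within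
  -- c'/8 of the chart centre.
  set Λ₀ := max 1 (c' / η) with hΛ₀
  have hΛ₀1 : 1 ≤ Λ₀ := le_max_left _ _
  have hbound : ∀ φ : g.isometryGroup, P φ → ∀ x ∈ ball a₀ η,
      ‖fderiv ℝ (chartMap φ.1 p q) x‖ ≤ Λ₀ := by
    intro φ hφ x hx
    by_contra! hlt
    set Λ := ‖fderiv ℝ (chartMap φ.1 p q) x‖ with hΛ
    have hΛ1 : 1 ≤ Λ := hΛ₀1.trans hlt.le
    have hΛ0 : 0 < Λ := by linarith
    obtain ⟨h1, h2, h3⟩ := hPQ hφ (hηQ x (ball_subset_ball (by linarith) hx))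
    have hb := key φ Λ hΛ1 x h3 h1 (ball_subset_ball (min_le_left _ _) h2) le_rfl
    have hs : c' / Λ < η := by
      rw [div_lt_iff₀ hΛ0, mul_comm, ← div_lt_iff₀ hη0]
      exact (le_max_right _ _).trans_lt hlt
    -- Move by c'/Λ along a unit vector `v`: the values differ by at most c'/4 and the Taylor
    -- remainder is at most c'/4, so (c'/Λ)‖Du v‖ ≤ c'/2. Hence the operator norm Λ is at most Λ/2,
    -- contradicting Λ ≥ 1.
    have hhalf : Λ ≤ Λ / 2 := by
      refine ContinuousLinearMap.opNorm_le_of_unit_norm (by positivity) fun v hv ↦ ?_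
      set x' := x + (c' / Λ) • v with hx'
      have hnorm : ‖x' - x‖ = c' / Λ := by
        rw [hx', add_sub_cancel_left, norm_smul, hv, mul_one, Real.norm_of_nonneg (by positivity)]
      have hx'b : x' ∈ ball x (c / Λ) := by
        rw [mem_ball, dist_eq_norm, hnorm]
        gcongr
      have htaylor := norm_sub_sub_fderiv_le
        ((contDiffOn_two_chartMap φ p q).mono fun z hz ↦ (hb z hz).1)
        (fun z hz ↦ (hb z hz).2.2.2) hx'b
      rw [hnorm] at htaylor
      have hx'Q : x' ∈ ball a₀ η' := by
        have := mem_ball.1 hx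
        rw [mem_ball]
        calc dist x' a₀ ≤ dist x' x + dist x a₀ := dist_triangle _ _ _
          _ < η + η := by rw [dist_eq_norm x' x, hnorm]; linarith
          _ = η' := by rw [hη]; ring
      have h2' := mem_ball.1 ((hPQ hφ (hηQ x' hx'Q)).2.1)
      have h2'' := mem_ball.1 h2
      have hosc : ‖chartMap φ.1 p q x' - chartMap φ.1 p q x‖ ≤ c' / 4 := by
        rw [← dist_eq_norm]
        have := dist_triangle_right (chartMap φ.1 p q x') (chartMap φ.1 p q x)
          (extChartAt (𝓡 n) q q)
        have := min_le_right ρ (c' / 8)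
        linarith
      have e1 : C * Λ ^ 2 * (c' / Λ) ^ 2 ≤ c' / 4 := by
        calc C * Λ ^ 2 * (c' / Λ) ^ 2 = (C * c') * c' := by field_simp
          _ ≤ 1 / 4 * c' := by gcongr
          _ = c' / 4 := by ring
      have e2 : x' - x = (c' / Λ) • v := by rw [hx', add_sub_cancel_left]
      have e3 : (c' / Λ) * ‖fderiv ℝ (chartMap φ.1 p q) x v‖ ≤ c' / 2 := by
        calc (c' / Λ) * ‖fderiv ℝ (chartMap φ.1 p q) x v‖
            = ‖fderiv ℝ (chartMap φ.1 p q) x (x' - x)‖ := by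
              rw [e2, map_smul, norm_smul, Real.norm_of_nonneg (by positivity)]
          _ = ‖(chartMap φ.1 p q x' - chartMap φ.1 p q x) - (chartMap φ.1 p q x' -
              chartMap φ.1 p q x - fderiv ℝ (chartMap φ.1 p q) x (x' - x))‖ := by
              rw [sub_sub_cancel]
          _ ≤ _ := norm_sub_le _ _
          _ ≤ c' / 2 := by linarith
      rw [div_mul_eq_mul_div, div_le_iff₀ hΛ0] at e3
      have : c' * ‖fderiv ℝ (chartMap φ.1 p q) x v‖ ≤ c' * (Λ / 2) := by linarith
      exact le_of_mul_le_mul_left this hc'0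
    linarith
  refine ⟨c / Λ₀, by positivity, C * Λ₀ ^ 2, by positivity, ?_⟩
  rw [nhds_prod_eq]
  filter_upwards [prod_mem_prod hP (ball_mem_nhds a₀ hη0)] with a ha x hx
  obtain ⟨h1, h2, h3⟩ := hPQ ha.1 (hηQ a.2 (ball_subset_ball (by linarith) ha.2))
  have := key a.1 Λ₀ hΛ₀1 a.2 h3 h1 (ball_subset_ball (min_le_left _ _) h2)
    (hbound a.1 ha.1 a.2 ha.2) x hx
  exact ⟨this.1, this.2.2.2⟩

/-- Isometries converging in the compact-open topology converge with their derivatives. -/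
theorem tendsto_fderiv_chartMap [T2Space M] (ψ : g.isometryGroup) {p q : M} (hq : ψ.1 p = q) :
    Tendsto (fun a : g.isometryGroup × EuclideanSpace ℝ (Fin n) ↦
      fderiv ℝ (chartMap a.1.1 p q) a.2) (𝓝 (ψ, extChartAt (𝓡 n) p p))
      (𝓝 (fderiv ℝ (chartMap ψ.1 p q) (extChartAt (𝓡 n) p p))) := by
  obtain ⟨r, hr, C, hC, hev⟩ := exists_eventually_hessian_bound ψ p
  rw [hq] at hev
  set a₀ := extChartAt (𝓡 n) p p with ha₀
  have hself := hev.self_of_nhds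
  refine tendsto_clm_of_apply fun v ↦ ?_
  rw [Metric.tendsto_nhds]
  intro ε hε
  -- Derivatives are compared through difference quotients with one fixed step `s`: the two Taylor
  -- remainders, divided by `s`, total at most 2Cs‖v‖² < ε/2, and the quotients themselves become
  -- close because the values converge.
  obtain ⟨s, hs0, hs1, hs2⟩ : ∃ s > 0, s * ‖v‖ < r ∧ 2 * C * s * ‖v‖ ^ 2 < ε / 2 := by
    refine ⟨min (r / (2 * (‖v‖ + 1))) (ε / (4 * (2 * C * ‖v‖ ^ 2 + 1))), by positivity, ?_, ?_⟩
    · calc _ ≤ r / (2 * (‖v‖ + 1)) * ‖v‖ := by gcongr; exact min_le_left _ _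
        _ < r := by
          rw [div_mul_eq_mul_div, div_lt_iff₀ (by positivity)]
          nlinarith [norm_nonneg v]
    · calc _ = min (r / (2 * (‖v‖ + 1))) (ε / (4 * (2 * C * ‖v‖ ^ 2 + 1))) *
            (2 * C * ‖v‖ ^ 2) := by ring
        _ ≤ ε / (4 * (2 * C * ‖v‖ ^ 2 + 1)) * (2 * C * ‖v‖ ^ 2) := by
          gcongr; exact min_le_right _ _
        _ < ε / 2 := by
          rw [div_mul_eq_mul_div, div_lt_iff₀ (by positivity)]
          have : 0 ≤ 2 * C * ‖v‖ ^ 2 := by positivity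
          nlinarith
  have hmem : ∀ x : EuclideanSpace ℝ (Fin n), x + s • v ∈ ball x r := fun x ↦ by
    rw [mem_ball, dist_eq_norm, add_sub_cancel_left, norm_smul, Real.norm_of_nonneg hs0.le]
    exact hs1
  have hd0 : a₀ ∈ chartDomain ψ.1 p q := (hself a₀ (mem_ball_self hr)).1
  have hc1 := continuousAt_chartMap hd0
  have hc2 : ContinuousAt (fun a : g.isometryGroup × EuclideanSpace ℝ (Fin n) ↦
      chartMap a.1.1 p q (a.2 + s • v)) (ψ, a₀) :=
    ContinuousAt.comp (f := fun a : g.isometryGroup × EuclideanSpace ℝ (Fin n) ↦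
      (a.1, a.2 + s • v)) (continuousAt_chartMap (hself _ (hmem a₀)).1)
      (by fun_prop)
  have hc3 := Metric.tendsto_nhds.1 (hc2.sub hc1) (s * (ε / 2)) (by positivity)
  filter_upwards [hev, hc3] with a ha hΔ
  have htaylor : ∀ (φ : g.isometryGroup) (x : EuclideanSpace ℝ (Fin n)),
      (∀ z ∈ ball x r, z ∈ chartDomain φ.1 p q ∧
        ‖fderiv ℝ (fderiv ℝ (chartMap φ.1 p q)) z‖ ≤ C) →
      ‖chartMap φ.1 p q (x + s • v) - chartMap φ.1 p q x - s • fderiv ℝ (chartMap φ.1 p q) x v‖ ≤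
        C * (s * ‖v‖) ^ 2 := by
    intro φ x hφ
    have := norm_sub_sub_fderiv_le ((contDiffOn_two_chartMap φ p q).mono fun z hz ↦ (hφ z hz).1)
      (fun z hz ↦ (hφ z hz).2) (hmem x)
    rwa [add_sub_cancel_left, map_smul, norm_smul, Real.norm_of_nonneg hs0.le] at this
  have t1 := htaylor a.1 a.2 ha
  have t2 := htaylor ψ a₀ hself
  rw [dist_eq_norm] at hΔ ⊢
  simp only [Pi.sub_apply] at hΔ
  set d₁ := chartMap a.1.1 p q (a.2 + s • v) - chartMap a.1.1 p q a.2
  set d₂ := chartMap ψ.1 p q (a₀ + s • v) - chartMap ψ.1 p q a₀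
  set y₁ := fderiv ℝ (chartMap a.1.1 p q) a.2 v
  set y₂ := fderiv ℝ (chartMap ψ.1 p q) a₀ v
  have e1 : s * ‖y₁ - y₂‖ ≤ ‖d₁ - d₂‖ + (‖d₁ - s • y₁‖ + ‖d₂ - s • y₂‖) := by
    calc s * ‖y₁ - y₂‖ = ‖s • (y₁ - y₂)‖ := by rw [norm_smul, Real.norm_of_nonneg hs0.le]
      _ = ‖(d₁ - d₂) - ((d₁ - s • y₁) - (d₂ - s • y₂))‖ := by congr 1; rw [smul_sub]; abel
      _ ≤ ‖d₁ - d₂‖ + ‖(d₁ - s • y₁) - (d₂ - s • y₂)‖ := norm_sub_le _ _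
      _ ≤ _ := by gcongr; exact norm_sub_le _ _
  have e2 : s * ‖y₁ - y₂‖ < s * ε := by
    calc s * ‖y₁ - y₂‖ < s * (ε / 2) + (C * (s * ‖v‖) ^ 2 + C * (s * ‖v‖) ^ 2) := by linarith
      _ = s * (ε / 2 + 2 * C * s * ‖v‖ ^ 2) := by ring
      _ ≤ s * (ε / 2 + ε / 2) := by gcongr
      _ = s * ε := by ring
  exact lt_of_mul_lt_mul_left e2 hs0.le

theorem tendsto_tmap_of_tendsto_fderiv {ι : Type*} {l : Filter ι} {ψ : ι → g.isometryGroup}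
    {f : ι → TangentBundle (𝓡 n) M} {w w' : TangentBundle (𝓡 n) M} {p q : M}
    {A : EuclideanSpace ℝ (Fin n) →L[ℝ] EuclideanSpace ℝ (Fin n)}
    (hp : w.proj ∈ (extChartAt (𝓡 n) p).source) (hq : w'.proj ∈ (extChartAt (𝓡 n) q).source)
    (hf : Tendsto f l (𝓝 w)) (hψ : Tendsto (fun i ↦ (ψ i).1 (f i).proj) l (𝓝 w'.proj))
    (hA : Tendsto (fun i ↦ fderiv ℝ (chartMap (ψ i).1 p q) (extChartAt (𝓡 n) p (f i).proj)) l
      (𝓝 A)) (hw' : (tangentTriv q w').2 = A (tangentTriv p w).2) :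
    Tendsto (fun i ↦ tmap (ψ i) (f i)) l (𝓝 w') := by
  obtain ⟨hf1, hf2⟩ := (tendsto_tangentBundle_iff hp).1 hf
  refine (tendsto_tangentBundle_iff hq).2 ⟨hψ, ?_⟩
  rw [hw']
  refine ((isBoundedBilinearMap_apply.continuous.tendsto (A, (tangentTriv p w).2)).comp
    (hA.prodMk_nhds hf2)).congr' ?_
  filter_upwards [hf1.eventually ((isOpen_extChartAt_source (I := 𝓡 n) p).mem_nhds hp),
    hψ.eventually ((isOpen_extChartAt_source (I := 𝓡 n) q).mem_nhds hq)] with i h1 h2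
  exact (tangentTriv_tmap (ψ i) h1 h2).symm

theorem tendsto_tmap [T2Space M] (ψ : g.isometryGroup) (w : TangentBundle (𝓡 n) M) :
    Tendsto (fun a : g.isometryGroup × TangentBundle (𝓡 n) M ↦ tmap a.1 a.2) (𝓝 (ψ, w))
      (𝓝 (tmap ψ w)) := by
  have hp := mem_extChartAt_source (I := 𝓡 n) w.proj
  obtain ⟨q, hψq⟩ : ∃ q, ψ.1 w.proj = q := ⟨_, rfl⟩
  have hq : ψ.1 w.proj ∈ (extChartAt (𝓡 n) q).source := hψq ▸ mem_extChartAt_source _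
  have hfst : Tendsto (fun a : g.isometryGroup × TangentBundle (𝓡 n) M ↦ a.1) (𝓝 (ψ, w)) (𝓝 ψ) :=
    continuous_fst.tendsto (ψ, w)
  have hsnd : Tendsto (fun a : g.isometryGroup × TangentBundle (𝓡 n) M ↦ a.2) (𝓝 (ψ, w)) (𝓝 w) :=
    continuous_snd.tendsto (ψ, w)
  have hproj := ((tendsto_tangentBundle_iff hp).1 hsnd).1
  have happ : Tendsto (fun a : g.isometryGroup × TangentBundle (𝓡 n) M ↦ a.1.1 a.2.proj)
      (𝓝 (ψ, w)) (𝓝 (ψ.1 w.proj)) :=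
    (continuous_isometry_apply.tendsto (ψ, w.proj)).comp (hfst.prodMk_nhds hproj)
  have hx : Tendsto (fun a : g.isometryGroup × TangentBundle (𝓡 n) M ↦
      extChartAt (𝓡 n) w.proj a.2.proj) (𝓝 (ψ, w)) (𝓝 (extChartAt (𝓡 n) w.proj w.proj)) :=
    (continuousAt_extChartAt (I := 𝓡 n) w.proj).tendsto.comp hproj
  have hD := (tendsto_fderiv_chartMap ψ hψq).comp (hfst.prodMk_nhds hx)
  simp only [Function.comp_def] at hD
  exact tendsto_tmap_of_tendsto_fderiv hp hq hsnd happ hD (tangentTriv_tmap ψ hp hq)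

/-- Isometries act continuously on the tangent bundle. -/
theorem continuous_tmap_apply [T2Space M] :
    Continuous fun a : g.isometryGroup × TangentBundle (𝓡 n) M ↦ tmap a.1 a.2 :=
  continuous_iff_continuousAt.2 fun a ↦ tendsto_tmap a.1 a.2

theorem continuous_smul_orthonormalFrame [T2Space M] {k l : ℕ} :
    Continuous fun a : g.isometryGroup × OrthonormalFrame g k l ↦ a.1 • a.2 := by
  rw [continuous_induced_rng]
  have hF : Continuous fun a : g.isometryGroup × OrthonormalFrame g k l ↦ a.2.toProd :=
    (continuous_induced_dom (f := OrthonormalFrame.toProd)).comp continuous_snd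
  refine Continuous.prodMk ?_ (continuous_pi fun i ↦ ?_)
  · exact continuous_isometry_apply.comp (continuous_fst.prodMk (continuous_fst.comp hF))
  · exact continuous_tmap_apply.comp
      (continuous_fst.prodMk ((continuous_apply i).comp (continuous_snd.comp hF)))

end Continuity

/-! ### Limits of tangent maps along an ultrafilter. -/

/-- Operators that are bounded on a basis, up to a small perturbation of the basis, are bounded. -/
theorem exists_eventually_norm_le_of_basis {E F : Type*} [NormedAddCommGroup E] [NormedSpace ℝ E]
    [FiniteDimensional ℝ E] [NormedAddCommGroup F] [NormedSpace ℝ F] [FiniteDimensional ℝ F]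
    {ι κ : Type*} [Finite κ] {l : Filter ι} {A : ι → E →L[ℝ] F} {e : ι → κ → E}
    (b : Module.Basis κ ℝ E) {c : κ → F} (he : ∀ j, Tendsto (fun i ↦ e i j) l (𝓝 (b j)))
    (hA : ∀ j, Tendsto (fun i ↦ A i (e i j)) l (𝓝 (c j))) : ∃ K, ∀ᶠ i in l, ‖A i‖ ≤ K := by
  let B : ι → E →L[ℝ] E := fun i ↦ LinearMap.toContinuousLinearMap (b.constr ℝ (e i))
  let C : E →L[ℝ] F := LinearMap.toContinuousLinearMap (b.constr ℝ c)
  have hBb : ∀ i j, B i (b j) = e i j := fun i j ↦ by simp [B]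
  have hB : Tendsto B l (𝓝 (ContinuousLinearMap.id ℝ E)) :=
    tendsto_clm_of_basis b fun j ↦ by simpa [hBb] using he j
  have hAB : Tendsto (fun i ↦ (A i).comp (B i)) l (𝓝 C) :=
    tendsto_clm_of_basis b fun j ↦ by simpa [hBb, C] using hA j
  refine ⟨2 * (‖C‖ + 1), ?_⟩
  filter_upwards [Metric.tendsto_nhds.1 hB (1 / 2) (by norm_num),
    hAB.norm.eventually (gt_mem_nhds (lt_add_one ‖C‖))] with i h1 h2
  rw [dist_eq_norm, norm_sub_rev] at h1
  -- Split A = AB + A(1 - B), where `B i` carries the basis to the perturbed one and tends to the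
  -- identity; the second term is absorbed once ‖1 - B‖ < 1/2.
  have h3 : ‖A i‖ ≤ ‖(A i).comp (B i)‖ + ‖A i‖ * (1 / 2) := by
    calc ‖A i‖ = ‖(A i).comp (B i) + (A i).comp (ContinuousLinearMap.id ℝ E - B i)‖ := by
          congr 1; ext v; simp
      _ ≤ ‖(A i).comp (B i)‖ + ‖(A i).comp (ContinuousLinearMap.id ℝ E - B i)‖ := norm_add_le _ _
      _ ≤ ‖(A i).comp (B i)‖ + ‖A i‖ * ‖ContinuousLinearMap.id ℝ E - B i‖ := by
          gcongr; exact ContinuousLinearMap.opNorm_comp_le _ _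
      _ ≤ _ := by gcongr
  linarith

section Limits

open Metric Bundle

variable {n : ℕ} {M : Type*} [TopologicalSpace M]
  [ChartedSpace (EuclideanSpace ℝ (Fin n)) M] [IsManifold (𝓡 n) ∞ M]
  {g : SemiRiemannianMetric n M} {ι : Type*}

/-- The tangent maps of a family of isometries converge continuously to `w'` at `w`. -/
def TangentLimit (l : Filter ι) (ψ : ι → g.isometryGroup) (w w' : TangentBundle (𝓡 n) M) : Prop :=
  Tendsto (fun a : ι × TangentBundle (𝓡 n) M ↦ tmap (ψ a.1) a.2) (l ×ˢ 𝓝 w) (𝓝 w')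

/-- The tangent maps of a family of isometries converge continuously at the tangent vectors at
`z`. -/
def HasTangentLimits (l : Filter ι) (ψ : ι → g.isometryGroup) (z : M) : Prop :=
  ∀ w : TangentBundle (𝓡 n) M, w.proj = z → ∃ w', TangentLimit l ψ w w'

theorem TangentLimit.comp {l : Filter ι} {ψ : ι → g.isometryGroup}
    {w w' : TangentBundle (𝓡 n) M} (h : TangentLimit l ψ w w') {κ : Type*} {l' : Filter κ}
    {s : κ → ι} {f : κ → TangentBundle (𝓡 n) M} (hs : Tendsto s l' l) (hf : Tendsto f l' (𝓝 w)) :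
    Tendsto (fun k ↦ tmap (ψ (s k)) (f k)) l' (𝓝 w') :=
  Tendsto.comp h (hs.prodMk hf)

theorem TangentLimit.tendsto {l : Filter ι} {ψ : ι → g.isometryGroup}
    {w w' : TangentBundle (𝓡 n) M} (h : TangentLimit l ψ w w') :
    Tendsto (fun i ↦ tmap (ψ i) w) l (𝓝 w') :=
  h.comp tendsto_id tendsto_const_nhds

theorem tendsto_proj {κ : Type*} {l : Filter κ} {f : κ → TangentBundle (𝓡 n) M}
    {w : TangentBundle (𝓡 n) M} (h : Tendsto f l (𝓝 w)) :
    Tendsto (fun k ↦ (f k).proj) l (𝓝 w.proj) :=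
  ((tendsto_tangentBundle_iff (mem_extChartAt_source w.proj)).1 h).1

/-- If isometries and their first two derivatives are bounded in charts on an open set, then their
tangent maps converge continuously along any ultrafilter. -/
theorem hasTangentLimits_of_bounded (U : Ultrafilter ι) (ψ : ι → g.isometryGroup) {p q : M}
    {O : Set (EuclideanSpace ℝ (Fin n))} (hO : IsOpen O) {R K : ℝ}
    (hR : closedBall (extChartAt (𝓡 n) q q) R ⊆ (extChartAt (𝓡 n) q).target)
    (hb : ∀ᶠ i in (U : Filter ι), ∀ x ∈ O, x ∈ chartDomain (ψ i).1 p q ∧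
      chartMap (ψ i).1 p q x ∈ closedBall (extChartAt (𝓡 n) q q) R ∧
      ‖fderiv ℝ (chartMap (ψ i).1 p q) x‖ ≤ K ∧
      ‖fderiv ℝ (fderiv ℝ (chartMap (ψ i).1 p q)) x‖ ≤ K)
    {z : M} (hz : z ∈ (extChartAt (𝓡 n) p).source) (hzO : extChartAt (𝓡 n) p z ∈ O) :
    HasTangentLimits U ψ z := by
  intro w hw
  subst hw
  set x := extChartAt (𝓡 n) p w.proj with hx
  obtain ⟨r, hr, hrO⟩ := Metric.isOpen_iff.1 hO x hzO
  -- Compactness gives limits of the value and of the derivative at the single point `x`; `hlip`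
  -- upgrades them to limits joint in the index and the point.
  obtain ⟨y, hy, hUy⟩ := (isCompact_closedBall (extChartAt (𝓡 n) q q) R).ultrafilter_le_nhds
    (U.map fun i ↦ chartMap (ψ i).1 p q x) (by
      rw [le_principal_iff]
      exact hb.mono fun i hi ↦ (hi x hzO).2.1)
  obtain ⟨A, -, hUA⟩ := (isCompact_closedBall
    (0 : EuclideanSpace ℝ (Fin n) →L[ℝ] EuclideanSpace ℝ (Fin n)) K).ultrafilter_le_nhds
    (U.map fun i ↦ fderiv ℝ (chartMap (ψ i).1 p q) x) (by
      rw [le_principal_iff]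
      refine hb.mono fun i hi ↦ ?_
      simpa using (hi x hzO).2.2.1)
  have hUy' : Tendsto (fun i ↦ chartMap (ψ i).1 p q x) U (𝓝 y) := hUy
  have hUA' : Tendsto (fun i ↦ fderiv ℝ (chartMap (ψ i).1 p q) x) U (𝓝 A) := hUA
  have hlip : ∀ᶠ a : ι × EuclideanSpace ℝ (Fin n) in (U : Filter ι) ×ˢ 𝓝 x,
      ‖chartMap (ψ a.1).1 p q a.2 - chartMap (ψ a.1).1 p q x‖ ≤ K * ‖a.2 - x‖ ∧
      ‖fderiv ℝ (chartMap (ψ a.1).1 p q) a.2 - fderiv ℝ (chartMap (ψ a.1).1 p q) x‖ ≤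
        K * ‖a.2 - x‖ := by
    filter_upwards [prod_mem_prod hb (ball_mem_nhds x hr)] with a ha
    have hu : ContDiffOn ℝ 2 (chartMap (ψ a.1).1 p q) (ball x r) :=
      (contDiffOn_two_chartMap (ψ a.1) p q).mono fun x' hx' ↦ (ha.1 x' (hrO hx')).1
    refine ⟨(convex_ball x r).norm_image_sub_le_of_norm_hasFDerivWithin_le (fun x' hx' ↦
        ((hu.differentiableOn (by simp)).differentiableAt
          (isOpen_ball.mem_nhds hx')).hasFDerivAt.hasFDerivWithinAt)
        (fun x' hx' ↦ (ha.1 x' (hrO hx')).2.2.1) (mem_ball_self hr) ha.2,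
      (convex_ball x r).norm_image_sub_le_of_norm_hasFDerivWithin_le (fun x' hx' ↦
        (((hu.fderiv_of_isOpen isOpen_ball (m := 1) (by norm_num)).differentiableOn
          (by simp)).differentiableAt
          (isOpen_ball.mem_nhds hx')).hasFDerivAt.hasFDerivWithinAt)
        (fun x' hx' ↦ (ha.1 x' (hrO hx')).2.2.2) (mem_ball_self hr) ha.2⟩
  have hsmall : Tendsto (fun a : ι × EuclideanSpace ℝ (Fin n) ↦ K * ‖a.2 - x‖)
      ((U : Filter ι) ×ˢ 𝓝 x) (𝓝 0) := by
    have h1 : Tendsto (fun x' : EuclideanSpace ℝ (Fin n) ↦ K * ‖x' - x‖) (𝓝 x)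
        (𝓝 (K * ‖x - x‖)) := Continuous.tendsto (by fun_prop) x
    rw [sub_self, norm_zero, mul_zero] at h1
    exact h1.comp tendsto_snd
  have hjet₀ : Tendsto (fun a : ι × EuclideanSpace ℝ (Fin n) ↦ chartMap (ψ a.1).1 p q a.2)
      ((U : Filter ι) ×ˢ 𝓝 x) (𝓝 y) := by
    have h1 := (squeeze_zero_norm' (hlip.mono fun a ha ↦ ha.1) hsmall).add (hUy'.comp tendsto_fst)
    simpa using h1
  have hjet₁ : Tendsto (fun a : ι × EuclideanSpace ℝ (Fin n) ↦
      fderiv ℝ (chartMap (ψ a.1).1 p q) a.2) ((U : Filter ι) ×ˢ 𝓝 x) (𝓝 A) := by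
    have h1 := (squeeze_zero_norm' (hlip.mono fun a ha ↦ ha.2) hsmall).add (hUA'.comp tendsto_fst)
    simpa using h1
  have hyt : y ∈ (extChartAt (𝓡 n) q).target := hR hy
  have hys := (extChartAt (𝓡 n) q).map_target hyt
  have hsnd : Tendsto (fun a : ι × TangentBundle (𝓡 n) M ↦ a.2) ((U : Filter ι) ×ˢ 𝓝 w) (𝓝 w) :=
    tendsto_snd
  have hproj := tendsto_proj hsnd
  have hφ : Tendsto (fun a : ι × TangentBundle (𝓡 n) M ↦ extChartAt (𝓡 n) p a.2.proj)
      ((U : Filter ι) ×ˢ 𝓝 w) (𝓝 x) :=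
    (continuousAt_extChartAt' (I := 𝓡 n) hz).tendsto.comp hproj
  have hpair : Tendsto (fun a : ι × TangentBundle (𝓡 n) M ↦
      (a.1, extChartAt (𝓡 n) p a.2.proj)) ((U : Filter ι) ×ˢ 𝓝 w) ((U : Filter ι) ×ˢ 𝓝 x) :=
    tendsto_fst.prodMk hφ
  have hA := hjet₁.comp hpair
  have hval := ((continuousOn_extChartAt_symm (I := 𝓡 n) q).continuousAt
    ((isOpen_extChartAt_target q).mem_nhds hyt)).tendsto.comp (hjet₀.comp hpair)
  simp only [Function.comp_def] at hA hval
  refine ⟨coordVec q ((extChartAt (𝓡 n) q).symm y) (A (tangentTriv p w).2),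
    tendsto_tmap_of_tendsto_fderiv hz hys hsnd (hval.congr' ?_) hA
      (tangentTriv_coordVec hys _)⟩
  filter_upwards [tendsto_fst.eventually hb,
    hproj.eventually ((isOpen_extChartAt_source (I := 𝓡 n) p).mem_nhds hz),
    hφ.eventually (hO.mem_nhds hzO)] with a h1 h2 h3
  have h4 := (h1 _ h3).1.2
  rw [mem_preimage, (extChartAt (𝓡 n) p).left_inv h2] at h4
  rw [chartMap_extChartAt _ h2, (extChartAt (𝓡 n) q).left_inv h4]

/-- If isometries have bounded derivatives at points converging to `p`, and their values there
converge, then their tangent maps converge continuously near `p` along any ultrafilter. -/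
theorem eventually_hasTangentLimits [T2Space M] (U : Ultrafilter ι) (ψ : ι → g.isometryGroup)
    {z : ι → M} {p q : M} (hz : Tendsto z U (𝓝 p))
    (hψz : Tendsto (fun i ↦ (ψ i).1 (z i)) U (𝓝 q)) {K : ℝ}
    (hK : ∀ᶠ i in (U : Filter ι), ‖fderiv ℝ (chartMap (ψ i).1 p q) (extChartAt (𝓡 n) p (z i))‖ ≤ K) :
    ∀ᶠ z' in 𝓝 p, HasTangentLimits U ψ z' := by
  obtain ⟨ρ, hρ, c, hc, C, hC, hp, hq, key⟩ := exists_uniform_chart_bound g p q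
  set Λ := max 1 K with hΛ
  have hΛ1 : 1 ≤ Λ := le_max_left _ _
  have hΛ0 : 0 < Λ := by linarith
  -- Half of c/Λ, so that the fixed ball of radius `r` about the image of `p` lies in the moving
  -- balls of radius c/Λ about the images of `z i`.
  set r := c / Λ / 2 with hr
  have hr0 : 0 < r := by positivity
  have hφ : Tendsto (fun i ↦ extChartAt (𝓡 n) p (z i)) U (𝓝 (extChartAt (𝓡 n) p p)) :=
    (continuousAt_extChartAt (I := 𝓡 n) p).tendsto.comp hz
  have hφq : Tendsto (fun i ↦ extChartAt (𝓡 n) q ((ψ i).1 (z i))) U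
      (𝓝 (extChartAt (𝓡 n) q q)) :=
    (continuousAt_extChartAt (I := 𝓡 n) q).tendsto.comp hψz
  have hb : ∀ᶠ i in (U : Filter ι), ∀ x ∈ ball (extChartAt (𝓡 n) p p) r,
      x ∈ chartDomain (ψ i).1 p q ∧
      chartMap (ψ i).1 p q x ∈ closedBall (extChartAt (𝓡 n) q q) (2 * ρ) ∧
      ‖fderiv ℝ (chartMap (ψ i).1 p q) x‖ ≤ max (2 * Λ) (C * Λ ^ 2) ∧
      ‖fderiv ℝ (fderiv ℝ (chartMap (ψ i).1 p q)) x‖ ≤ max (2 * Λ) (C * Λ ^ 2) := by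
    filter_upwards [hK, hφ.eventually (ball_mem_nhds _ hr0), hφ.eventually (ball_mem_nhds _ hρ),
      hφq.eventually (ball_mem_nhds _ hρ),
      hz.eventually (extChartAt_source_mem_nhds (I := 𝓡 n) p),
      hψz.eventually (extChartAt_source_mem_nhds (I := 𝓡 n) q)] with i h1 h2 h3 h4 h5 h6 x hx
    have hx' : x ∈ ball (extChartAt (𝓡 n) p (z i)) (c / Λ) := by
      have := mem_ball.1 hx
      have := mem_ball'.1 h2
      rw [mem_ball]
      calc dist x (extChartAt (𝓡 n) p (z i)) ≤ dist x (extChartAt (𝓡 n) p p) +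
            dist (extChartAt (𝓡 n) p p) (extChartAt (𝓡 n) p (z i)) := dist_triangle _ _ _
        _ < r + r := by linarith
        _ = c / Λ := by rw [hr]; ring
    obtain ⟨k1, k2, k3, k4⟩ := key (ψ i) Λ hΛ1 _ h3 (extChartAt_mem_chartDomain h5 h6)
      (by rwa [chartMap_extChartAt _ h5]) (h1.trans (le_max_right _ _)) x hx'
    exact ⟨k1, ball_subset_closedBall k2, k3.trans (le_max_left _ _), k4.trans (le_max_right _ _)⟩
  filter_upwards [extChartAt_source_mem_nhds (I := 𝓡 n) p,
    (continuousAt_extChartAt (I := 𝓡 n) p).preimage_mem_nhds (ball_mem_nhds _ hr0)] with z' h1 h2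
  exact hasTangentLimits_of_bounded U ψ isOpen_ball hq hb h1 h2

/-- If isometries map frames converging at `p` to converging families of vectors, then their
tangent maps converge continuously near `p` along any ultrafilter. -/
theorem eventually_hasTangentLimits_of_frame [T2Space M] (U : Ultrafilter ι)
    (ψ : ι → g.isometryGroup) {κ : Type*} [Finite κ] {z : ι → M} {p q : M} (hz : Tendsto z U (𝓝 p))
    (hψz : Tendsto (fun i ↦ (ψ i).1 (z i)) U (𝓝 q)) {e : ι → κ → TangentBundle (𝓡 n) M}
    {e' f : κ → TangentBundle (𝓡 n) M} (hez : ∀ i j, (e i j).proj = z i)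
    (hep : ∀ j, (e' j).proj = p) (hfq : ∀ j, (f j).proj = q)
    (he : ∀ j, Tendsto (fun i ↦ e i j) U (𝓝 (e' j)))
    (b : Module.Basis κ ℝ (EuclideanSpace ℝ (Fin n))) (hb : ∀ j, (tangentTriv p (e' j)).2 = b j)
    (hf : ∀ j, Tendsto (fun i ↦ tmap (ψ i) (e i j)) U (𝓝 (f j))) :
    ∀ᶠ z' in 𝓝 p, HasTangentLimits U ψ z' := by
  have hps := mem_extChartAt_source (I := 𝓡 n) p
  have hqs := mem_extChartAt_source (I := 𝓡 n) q
  obtain ⟨K, hK⟩ := exists_eventually_norm_le_of_basis (l := (U : Filter ι))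
    (A := fun i ↦ fderiv ℝ (chartMap (ψ i).1 p q) (extChartAt (𝓡 n) p (z i)))
    (e := fun i j ↦ (tangentTriv p (e i j)).2) (c := fun j ↦ (tangentTriv q (f j)).2) b
    (fun j ↦ by
      rw [← hb j]
      exact ((tendsto_tangentBundle_iff (by rw [hep j]; exact hps)).1 (he j)).2)
    (fun j ↦ by
      have h1 := ((tendsto_tangentBundle_iff (q := q) (by rw [hfq j]; exact hqs)).1 (hf j)).2
      refine h1.congr' ?_
      filter_upwards [hz.eventually (extChartAt_source_mem_nhds (I := 𝓡 n) p),
        hψz.eventually (extChartAt_source_mem_nhds (I := 𝓡 n) q)] with i h2 h3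
      rw [tangentTriv_tmap (p := p) (q := q) (ψ i) (by rwa [hez]) (by rwa [hez]), hez])
  exact eventually_hasTangentLimits U ψ hz hψz hK

theorem HasTangentLimits.exists_tendsto {l : Filter ι} {ψ : ι → g.isometryGroup} {z : M}
    (h : HasTangentLimits l ψ z) : ∃ q, Tendsto (fun i ↦ (ψ i).1 z) l (𝓝 q) := by
  obtain ⟨w', hw'⟩ := h (coordVec z z 0) rfl
  exact ⟨w'.proj, tendsto_proj hw'.tendsto⟩

/-- Openness: convergence of the images of a basis at `p` bounds the derivatives there, and the
bound propagates to a neighbourhood. -/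
theorem HasTangentLimits.eventually [T2Space M] {U : Ultrafilter ι} {ψ : ι → g.isometryGroup}
    {p : M} (h : HasTangentLimits U ψ p) : ∀ᶠ z in 𝓝 p, HasTangentLimits U ψ z := by
  have hps := mem_extChartAt_source (I := 𝓡 n) p
  obtain ⟨q, hq⟩ := h.exists_tendsto
  let b := Module.finBasis ℝ (EuclideanSpace ℝ (Fin n))
  choose f hf using fun j ↦ h (coordVec p p (b j)) rfl
  refine eventually_hasTangentLimits_of_frame U ψ (z := fun _ ↦ p) tendsto_const_nhds hq
    (e := fun _ j ↦ coordVec p p (b j)) (fun _ _ ↦ rfl) (fun _ ↦ rfl) (fun j ↦ ?_)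
    (fun _ ↦ tendsto_const_nhds) b (fun j ↦ tangentTriv_coordVec hps _) fun j ↦ (hf j).tendsto
  exact tendsto_nhds_unique (tendsto_proj (hf j).tendsto) hq

/-- A limit of derivatives of isometries in charts preserves the metric. -/
theorem chartMetric_eq_of_tendsto {l : Filter ι} [l.NeBot] {ψ : ι → g.isometryGroup} {p q : M}
    {x y : EuclideanSpace ℝ (Fin n)}
    {A : EuclideanSpace ℝ (Fin n) →L[ℝ] EuclideanSpace ℝ (Fin n)}
    (hx : ∀ᶠ i in l, x ∈ chartDomain (ψ i).1 p q) (hy : y ∈ (extChartAt (𝓡 n) q).target)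
    (hxy : Tendsto (fun i ↦ chartMap (ψ i).1 p q x) l (𝓝 y))
    (hA : Tendsto (fun i ↦ fderiv ℝ (chartMap (ψ i).1 p q) x) l (𝓝 A))
    (v w : EuclideanSpace ℝ (Fin n)) :
    g.chartMetric q y (A v) (A w) = g.chartMetric p x v w := by
  have happ : ∀ v : EuclideanSpace ℝ (Fin n),
      Tendsto (fun i ↦ fderiv ℝ (chartMap (ψ i).1 p q) x v) l (𝓝 (A v)) := fun v ↦
    ((ContinuousLinearMap.apply ℝ (EuclideanSpace ℝ (Fin n)) v).continuous.tendsto A).comp hA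
  have hg : Tendsto (fun i ↦ g.chartMetric q (chartMap (ψ i).1 p q x)) l
      (𝓝 (g.chartMetric q y)) :=
    ((g.contDiffOn_chartMetric q).continuousOn.continuousAt
      ((isOpen_extChartAt_target q).mem_nhds hy)).tendsto.comp hxy
  have hcont : Continuous fun a : (EuclideanSpace ℝ (Fin n) →L[ℝ] EuclideanSpace ℝ (Fin n) →L[ℝ] ℝ) ×
      EuclideanSpace ℝ (Fin n) × EuclideanSpace ℝ (Fin n) ↦ a.1 a.2.1 a.2.2 := by fun_prop
  have hlim := (hcont.tendsto (g.chartMetric q y, A v, A w)).comp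
    (hg.prodMk_nhds ((happ v).prodMk_nhds (happ w)))
  refine tendsto_nhds_unique hlim (tendsto_const_nhds.congr' ?_)
  filter_upwards [hx] with i hi
  exact (g.chartMetric_fderiv_chartMap (mdifferentiable_isometry (ψ i)) (ψ i).2.2.2 hi v w).symm

/-- If the tangent maps of isometries converge at `p`, with values converging to `q`, then the
tangent maps of the inverse isometries converge at `q`. -/
theorem HasTangentLimits.inv [T2Space M] {U : Ultrafilter ι} {ψ : ι → g.isometryGroup}
    {p q : M} (h : HasTangentLimits U ψ p) (hq : Tendsto (fun i ↦ (ψ i).1 p) U (𝓝 q)) :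
    HasTangentLimits U (fun i ↦ (ψ i)⁻¹) q := by
  have hps := mem_extChartAt_source (I := 𝓡 n) p
  have hqs := mem_extChartAt_source (I := 𝓡 n) q
  have hev := hq.eventually (extChartAt_source_mem_nhds (I := 𝓡 n) q)
  choose! L hL using h
  have hLq : ∀ v, (L (coordVec p p v)).proj = q := fun v ↦
    tendsto_nhds_unique (tendsto_proj (hL (coordVec p p v) rfl).tendsto) hq
  have hcoord : ∀ v, Tendsto (fun i ↦ fderiv ℝ (chartMap (ψ i).1 p q) (extChartAt (𝓡 n) p p) v) U
      (𝓝 (tangentTriv q (L (coordVec p p v))).2) := fun v ↦ by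
    refine ((tendsto_tangentBundle_iff (by rw [hLq]; exact hqs)).1
      (hL (coordVec p p v) rfl).tendsto).2.congr' ?_
    filter_upwards [hev] with i hi
    exact tangentTriv_tmap_coordVec (ψ i) hps hi v
  obtain ⟨A, hA⟩ := exists_tendsto_clm fun v ↦ ⟨_, hcoord v⟩
  have hAv : ∀ v, (tangentTriv q (L (coordVec p p v))).2 = A v := fun v ↦
    tendsto_nhds_unique (hcoord v)
      (((ContinuousLinearMap.apply ℝ (EuclideanSpace ℝ (Fin n)) v).continuous.tendsto A).comp hA)
  have hiso := chartMetric_eq_of_tendsto (p := p) (q := q) (l := (U : Filter ι)) (ψ := ψ)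
    (hev.mono fun i hi ↦ extChartAt_mem_chartDomain hps hi) (mem_extChartAt_target q)
    (((continuousAt_extChartAt (I := 𝓡 n) q).tendsto.comp hq).congr fun i ↦
      (chartMap_extChartAt _ hps).symm) hA
  -- The limit derivative preserves the nondegenerate metric, so it cannot degenerate. The images of
  -- a basis at `p` therefore converge to a basis at `q`, and the inverses carry them back to
  -- constant vectors.
  have hinj : Function.Injective (A : EuclideanSpace ℝ (Fin n) →ₗ[ℝ] EuclideanSpace ℝ (Fin n)) := by
    rw [injective_iff_map_eq_zero]
    intro v hv
    refine g.chartMetric_nondegenerate p (mem_extChartAt_target p) v fun w ↦ ?_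
    rw [← hiso v w, show A v = 0 from hv]
    simp
  let b := Module.finBasis ℝ (EuclideanSpace ℝ (Fin n))
  refine (eventually_hasTangentLimits_of_frame U (fun i ↦ (ψ i)⁻¹) (z := fun i ↦ (ψ i).1 p) hq
    (q := p) ?_ (e := fun i j ↦ tmap (ψ i) (coordVec p p (b j)))
    (e' := fun j ↦ L (coordVec p p (b j))) (f := fun j ↦ coordVec p p (b j)) (fun _ _ ↦ rfl)
    (fun j ↦ hLq _) (fun _ ↦ rfl) (fun j ↦ (hL _ rfl).tendsto)
    (b.map (LinearEquiv.ofInjectiveEndo _ hinj)) (fun j ↦ ?_) (fun j ↦ ?_)).self_of_nhds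
  · refine tendsto_const_nhds.congr fun i ↦ ?_
    exact ((ψ i).1.symm_apply_apply p).symm
  · rw [hAv]
    simp
  · simp only [tmap_inv_tmap]
    exact tendsto_const_nhds

/-- The inverses have some limit at `w'`; evaluating them along the images of `w`, which tend to
`w'`, identifies it as `w`. -/
theorem TangentLimit.inv [T2Space M] {U : Ultrafilter ι} {ψ : ι → g.isometryGroup}
    {w w' : TangentBundle (𝓡 n) M} (h : TangentLimit U ψ w w')
    (hp : HasTangentLimits U ψ w.proj) : TangentLimit U (fun i ↦ (ψ i)⁻¹) w' w := by
  obtain ⟨w'', hw''⟩ := hp.inv (tendsto_proj h.tendsto) w' rfl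
  have h1 := hw''.comp tendsto_id h.tendsto
  simp only [id, tmap_inv_tmap] at h1
  rwa [tendsto_nhds_unique tendsto_const_nhds h1]

/-- The derivatives of `ψ i` at good points `z` might blow up as z → p, shrinking the radius c/Λ, so
`ψ i` is not estimated directly. The maps ψ_a⁻¹ψ_b instead tend to the identity to first order at
`z`; their derivatives there are eventually below 2, and the bounds hold on radius c/2 however close
`z` is to `p`. Taking `z` and the points to be estimated within c/4 of `p` in the chart puts `p`
inside that ball. -/
theorem hasTangentLimits_of_mem_closure [T2Space M] {U : Ultrafilter ι} {ψ : ι → g.isometryGroup}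
    {p : M} (hp : p ∈ closure {z | HasTangentLimits U ψ z}) : HasTangentLimits U ψ p := by
  obtain ⟨ρ, hρ, c, hc, C, hC, -, hpt, key⟩ := exists_uniform_chart_bound g p p
  set a₀ := extChartAt (𝓡 n) p p with ha₀
  obtain ⟨z, ⟨hzs, hzb⟩, hz⟩ := mem_closure_iff_nhds.1 hp _ (inter_mem
    (extChartAt_source_mem_nhds (I := 𝓡 n) p)
    ((continuousAt_extChartAt (I := 𝓡 n) p).preimage_mem_nhds
      (ball_mem_nhds _ (show 0 < min ρ (c / 4) by positivity))))
  have hz' : HasTangentLimits U ψ z := hz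
  set x := extChartAt (𝓡 n) p z with hx
  have hlim : ∀ v, Tendsto (fun a : ι × ι ↦ tmap ((ψ a.1)⁻¹ * ψ a.2) (coordVec p z v))
      ((U : Filter ι) ×ˢ (U : Filter ι)) (𝓝 (coordVec p z v)) := by
    intro v
    obtain ⟨w', hw'⟩ := hz' (coordVec p z v) rfl
    have h1 := (hw'.inv hz').comp (tendsto_fst (f := (U : Filter ι)) (g := (U : Filter ι)))
      (hw'.tendsto.comp tendsto_snd)
    simp only [tmap_mul]
    exact h1
  have hval : Tendsto (fun a : ι × ι ↦ ((ψ a.1)⁻¹ * ψ a.2).1 z)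
      ((U : Filter ι) ×ˢ (U : Filter ι)) (𝓝 z) := tendsto_proj (hlim 0)
  have hsrc := hval.eventually ((isOpen_extChartAt_source (I := 𝓡 n) p).mem_nhds hzs)
  have hD : Tendsto (fun a : ι × ι ↦ fderiv ℝ (chartMap ((ψ a.1)⁻¹ * ψ a.2).1 p p) x)
      ((U : Filter ι) ×ˢ (U : Filter ι))
      (𝓝 (ContinuousLinearMap.id ℝ (EuclideanSpace ℝ (Fin n)))) := by
    refine tendsto_clm_of_apply fun v ↦ ?_
    have h1 := ((tendsto_tangentBundle_iff (q := p) hzs).1 (hlim v)).2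
    rw [tangentTriv_coordVec hzs] at h1
    refine h1.congr' ?_
    filter_upwards [hsrc] with a ha
    exact tangentTriv_tmap_coordVec _ hzs ha v
  have hφ : Tendsto (fun a : ι × ι ↦ extChartAt (𝓡 n) p (((ψ a.1)⁻¹ * ψ a.2).1 z))
      ((U : Filter ι) ×ˢ (U : Filter ι)) (𝓝 x) :=
    (continuousAt_extChartAt' (I := 𝓡 n) hzs).tendsto.comp hval
  have hxρ : x ∈ ball a₀ ρ := ball_subset_ball (min_le_left _ _) hzb
  have hev : ∀ᶠ a : ι × ι in (U : Filter ι) ×ˢ (U : Filter ι), ∀ x' ∈ ball a₀ (c / 4),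
      x' ∈ chartDomain ((ψ a.1)⁻¹ * ψ a.2).1 p p ∧
      chartMap ((ψ a.1)⁻¹ * ψ a.2).1 p p x' ∈ closedBall a₀ (2 * ρ) ∧
      ‖fderiv ℝ (chartMap ((ψ a.1)⁻¹ * ψ a.2).1 p p) x'‖ ≤ max (2 * 2) (C * 2 ^ 2) ∧
      ‖fderiv ℝ (fderiv ℝ (chartMap ((ψ a.1)⁻¹ * ψ a.2).1 p p)) x'‖ ≤
        max (2 * 2) (C * 2 ^ 2) := by
    filter_upwards [hsrc, hφ.eventually (isOpen_ball.mem_nhds hxρ),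
      hD.norm.eventually (gt_mem_nhds (ContinuousLinearMap.norm_id_le.trans_lt one_lt_two))] with
      a h1 h2 h3 x' hx'
    have hx'' : x' ∈ ball x (c / 2) := by
      have := mem_ball.1 hx'
      have := mem_ball'.1 (ball_subset_ball (min_le_right _ _) hzb)
      rw [mem_ball]
      calc dist x' x ≤ dist x' a₀ + dist a₀ x := dist_triangle _ _ _
        _ < c / 2 := by linarith
    obtain ⟨k1, k2, k3, k4⟩ := key ((ψ a.1)⁻¹ * ψ a.2) 2 one_le_two x hxρ
      (extChartAt_mem_chartDomain hzs h1) (by rwa [hx, chartMap_extChartAt _ hzs]) h3.le x' hx''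
    exact ⟨k1, ball_subset_closedBall k2, k3.trans (le_max_left _ _), k4.trans (le_max_right _ _)⟩
  -- Freeze the first index: ψ_j⁻¹ψ_i is bounded near `p` for almost all `i`, and composing its
  -- limit with the fixed ψ_j gives that of ψ_i.
  obtain ⟨j, hj⟩ := hev.curry.exists
  have hgood := hasTangentLimits_of_bounded U (fun i ↦ (ψ j)⁻¹ * ψ i) isOpen_ball hpt hj
    (mem_extChartAt_source p) (mem_ball_self (by positivity))
  intro w hw
  obtain ⟨w', hw'⟩ := hgood w hw
  refine ⟨tmap (ψ j) w', (((continuous_tmap (ψ j)).tendsto w').comp hw').congr fun a ↦ ?_⟩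
  rw [Function.comp_apply, tmap_mul, tmap_tmap_inv]

/-- On a connected manifold, tangent maps of isometries that converge continuously at a point
converge continuously everywhere. -/
theorem HasTangentLimits.all [T2Space M] [ConnectedSpace M] {U : Ultrafilter ι}
    {ψ : ι → g.isometryGroup} {p : M} (hp : HasTangentLimits U ψ p) (z : M) :
    HasTangentLimits U ψ z := by
  have h : {z | HasTangentLimits U ψ z} = univ := IsClopen.eq_univ
    ⟨isClosed_of_closure_subset fun z hz ↦ hasTangentLimits_of_mem_closure hz,
      isOpen_iff_mem_nhds.2 fun z hz ↦ HasTangentLimits.eventually hz⟩ ⟨p, hp⟩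
  exact (h ▸ mem_univ z : z ∈ {z | HasTangentLimits U ψ z})

end Limits

/-! ### The limit of isometries is an isometry; convergence from frames. -/

/-- The continuous limit of a family of functions is continuous. -/
theorem continuousAt_of_tendsto_prod {ι X Y : Type*} [TopologicalSpace X] [TopologicalSpace Y]
    [RegularSpace Y] {l : Filter ι} [l.NeBot] {F : ι → X → Y} {G : X → Y} {x : X}
    (h : ∀ᶠ y in 𝓝 x, Tendsto (fun a : ι × X ↦ F a.1 a.2) (l ×ˢ 𝓝 y) (𝓝 (G y))) :
    ContinuousAt G x := by
  refine (closed_nhds_basis (G x)).tendsto_right_iff.2 fun V ⟨hV, hVc⟩ ↦ ?_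
  have h1 : ∀ᶠ a : X × ι in 𝓝 x ×ˢ l, F a.2 a.1 ∈ V := by
    have := h.self_of_nhds.eventually hV
    rwa [prod_comm, eventually_map] at this
  filter_upwards [h1.curry, h] with y hy hyG
  have h2 : Tendsto (fun i ↦ F i y) l (𝓝 (G y)) :=
    hyG.comp (tendsto_id.prodMk tendsto_const_nhds)
  exact hVc.mem_of_tendsto h2 hy

/-- Differentiation of a limit whose derivatives converge continuously. -/
theorem hasFDerivAt_of_tendsto_prod {E G : Type*} [NormedAddCommGroup E] [NormedSpace ℝ E]
    [NormedAddCommGroup G] [NormedSpace ℝ G] {ι : Type*} {l : Filter ι} [l.NeBot]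
    {f : ι → E → G} {f' : ι → E → E →L[ℝ] G} {u : E → G} {u' : E → E →L[ℝ] G} {N : Set E}
    (hN : IsOpen N)
    (hf : ∀ x ∈ N, ∀ᶠ a : ι × E in l ×ˢ 𝓝 x, HasFDerivAt (f a.1) (f' a.1 a.2) a.2)
    (hu : ∀ x ∈ N, Tendsto (fun i ↦ f i x) l (𝓝 (u x)))
    (hu' : ∀ x ∈ N, Tendsto (fun a : ι × E ↦ f' a.1 a.2) (l ×ˢ 𝓝 x) (𝓝 (u' x))) :
    ∀ x ∈ N, HasFDerivAt u (u' x) x := by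
  intro x hx
  -- Continuity of `u'` turns joint convergence of the derivatives into uniform convergence near
  -- `x`, which permits differentiating the limit.
  have hc : ContinuousAt u' x := continuousAt_of_tendsto_prod <| by
    filter_upwards [hN.mem_nhds hx] with y hy using hu' y hy
  refine hasFDerivAt_of_tendstoUniformlyOnFilter (l := l) (f := f) (f' := f') ?_ (hf x hx) ?_
  · rw [tendstoUniformlyOnFilter_iff_tendsto]
    exact ((hc.tendsto.comp tendsto_snd).prodMk_nhds (hu' x hx)).mono_right
      (nhds_le_uniformity (u' x))
  · filter_upwards [hN.mem_nhds hx] with y hy using hu y hy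

section LimitIsometry

open Metric Bundle

variable {n : ℕ} {M : Type*} [TopologicalSpace M]
  [ChartedSpace (EuclideanSpace ℝ (Fin n)) M] [IsManifold (𝓡 n) ∞ M]
  {g : SemiRiemannianMetric n M} {ι : Type*}

theorem HasTangentLimits.exists_tendsto_prod {l : Filter ι} {ψ : ι → g.isometryGroup} {z : M}
    (h : HasTangentLimits l ψ z) :
    ∃ q, Tendsto (fun a : ι × M ↦ (ψ a.1).1 a.2) (l ×ˢ 𝓝 z) (𝓝 q) := by
  obtain ⟨w', hw'⟩ := h (coordVec z z 0) rfl
  exact ⟨w'.proj, tendsto_proj (hw'.comp tendsto_fst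
    ((tendsto_coordVec (mem_extChartAt_source (I := 𝓡 n) z) 0).comp tendsto_snd))⟩

/-- The continuous limit of isometries whose tangent maps converge is smooth and preserves the
metric. -/
theorem contMDiffAt_and_isometry_of_limit [T2Space M] {l : Filter ι} [l.NeBot]
    {ψ : ι → g.isometryGroup} (hψ : ∀ z, HasTangentLimits l ψ z) {f : M → M}
    (hf : ∀ z, Tendsto (fun a : ι × M ↦ (ψ a.1).1 a.2) (l ×ˢ 𝓝 z) (𝓝 (f z)))
    (hfc : Continuous f) (p : M) :
    ContMDiffAt (𝓡 n) (𝓡 n) ∞ f p ∧ ∀ v w : TangentSpace (𝓡 n) p,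
      g.val (f p) (mfderiv (𝓡 n) (𝓡 n) f p v) (mfderiv (𝓡 n) (𝓡 n) f p w) = g.val p v w := by
  have hps := mem_extChartAt_source (I := 𝓡 n) p
  obtain ⟨q, hpq⟩ : ∃ q, f p = q := ⟨_, rfl⟩
  have hqs : f p ∈ (extChartAt (𝓡 n) q).source := hpq ▸ mem_extChartAt_source (f p)
  set N : Set (EuclideanSpace ℝ (Fin n)) := chartDomain f p q with hNdef
  have hN : IsOpen N := isOpen_chartDomain hfc p q
  have hpN : extChartAt (𝓡 n) p p ∈ N := extChartAt_mem_chartDomain hps hqs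
  have hsymm : ∀ x ∈ N, Tendsto (extChartAt (𝓡 n) p).symm (𝓝 x)
      (𝓝 ((extChartAt (𝓡 n) p).symm x)) := fun x hx ↦
    ((continuousOn_extChartAt_symm (I := 𝓡 n) p).continuousAt
      ((isOpen_extChartAt_target p).mem_nhds hx.1)).tendsto
  have hψf : ∀ x ∈ N, Tendsto (fun a : ι × EuclideanSpace ℝ (Fin n) ↦
      (ψ a.1).1 ((extChartAt (𝓡 n) p).symm a.2)) (l ×ˢ 𝓝 x)
      (𝓝 (f ((extChartAt (𝓡 n) p).symm x))) := fun x hx ↦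
    (hf _).comp (tendsto_fst.prodMk ((hsymm x hx).comp tendsto_snd))
  have hdom : ∀ x ∈ N, ∀ᶠ a : ι × EuclideanSpace ℝ (Fin n) in l ×ˢ 𝓝 x,
      a.2 ∈ chartDomain (ψ a.1).1 p q := fun x hx ↦ by
    filter_upwards [(hψf x hx).eventually ((isOpen_extChartAt_source (I := 𝓡 n) q).mem_nhds hx.2),
      tendsto_snd.eventually ((isOpen_extChartAt_target (I := 𝓡 n) p).mem_nhds hx.1)] with a h1 h2
    exact ⟨h2, h1⟩
  have hjet₀ : ∀ x ∈ N, Tendsto (fun a : ι × EuclideanSpace ℝ (Fin n) ↦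
      chartMap (ψ a.1).1 p q a.2) (l ×ˢ 𝓝 x) (𝓝 (chartMap f p q x)) := fun x hx ↦
    ((continuousOn_extChartAt (I := 𝓡 n) q).continuousAt
      ((isOpen_extChartAt_source q).mem_nhds hx.2)).tendsto.comp (hψf x hx)
  have hex : ∀ x ∈ N, ∃ A : EuclideanSpace ℝ (Fin n) →L[ℝ] EuclideanSpace ℝ (Fin n),
      Tendsto (fun a : ι × EuclideanSpace ℝ (Fin n) ↦ fderiv ℝ (chartMap (ψ a.1).1 p q) a.2)
        (l ×ˢ 𝓝 x) (𝓝 A) := by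
    intro x hx
    have hzs := (extChartAt (𝓡 n) p).map_target hx.1
    refine exists_tendsto_clm fun v ↦ ?_
    obtain ⟨w', hw'⟩ := hψ _ (coordVec p ((extChartAt (𝓡 n) p).symm x) v) rfl
    have h1 := hw'.comp (tendsto_fst (f := l) (g := 𝓝 x))
      ((tendsto_coordVec hzs v).comp ((hsymm x hx).comp tendsto_snd))
    have hw'q : w'.proj ∈ (extChartAt (𝓡 n) q).source := by
      rw [tendsto_nhds_unique (tendsto_proj h1) (hψf x hx)]
      exact hx.2
    refine ⟨_, ((tendsto_tangentBundle_iff hw'q).1 h1).2.congr' ?_⟩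
    filter_upwards [hdom x hx] with a ha
    have h2 := tangentTriv_tmap_coordVec (ψ a.1) ((extChartAt (𝓡 n) p).map_target ha.1) ha.2 v
    rw [(extChartAt (𝓡 n) p).right_inv ha.1] at h2
    exact h2
  choose! A hA using hex
  have hcst : ∀ x : EuclideanSpace ℝ (Fin n),
      Tendsto (fun i : ι ↦ (i, x)) l (l ×ˢ 𝓝 x) := fun x ↦
    tendsto_id.prodMk tendsto_const_nhds
  have hjet₀' : ∀ x ∈ N, Tendsto (fun i ↦ chartMap (ψ i).1 p q x) l (𝓝 (chartMap f p q x)) := by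
    intro x hx
    have h1 := (hjet₀ x hx).comp (hcst x)
    simp only [Function.comp_def] at h1
    exact h1
  have hA' : ∀ x ∈ N, Tendsto (fun i ↦ fderiv ℝ (chartMap (ψ i).1 p q) x) l (𝓝 (A x)) := by
    intro x hx
    have h1 := (hA x hx).comp (hcst x)
    simp only [Function.comp_def] at h1
    exact h1
  have hu : ∀ x ∈ N, HasFDerivAt (chartMap f p q) (A x) x := by
    refine hasFDerivAt_of_tendsto_prod (f := fun i ↦ chartMap (ψ i).1 p q)
      (f' := fun i ↦ fderiv ℝ (chartMap (ψ i).1 p q)) (l := l) hN (fun x hx ↦ ?_)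
      hjet₀' hA
    filter_upwards [hdom x hx] with a ha
    exact (((contDiffOn_two_chartMap (ψ a.1) p q).differentiableOn (by simp)).differentiableAt
      ((isOpen_chartDomain (ψ a.1).1.continuous p q).mem_nhds ha)).hasFDerivAt
  set F := affineHessian (g.chartChristoffel p) (g.chartChristoffel q) with hF
  have hFs : ContDiffOn ℝ ∞ F
      ((extChartAt (𝓡 n) p).target ×ˢ (extChartAt (𝓡 n) q).target ×ˢ univ) :=
    contDiffOn_affineHessian (g.contDiffOn_chartChristoffel p) (g.contDiffOn_chartChristoffel q)
  have hT : ∀ x ∈ N, (x, chartMap f p q x, A x) ∈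
      (extChartAt (𝓡 n) p).target ×ˢ (extChartAt (𝓡 n) q).target ×ˢ
        (univ : Set (EuclideanSpace ℝ (Fin n) →L[ℝ] EuclideanSpace ℝ (Fin n))) := fun x hx ↦
    ⟨hx.1, chartMap_mem_target hx, mem_univ _⟩
  -- The second derivatives are `F` of the jets, so they converge because `F` is continuous; the
  -- limit jet then solves the same system, which makes the limit smooth.
  have hu' : ∀ x ∈ N, HasFDerivAt A (F (x, chartMap f p q x, A x)) x := by
    refine hasFDerivAt_of_tendsto_prod (f := fun i ↦ fderiv ℝ (chartMap (ψ i).1 p q))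
      (f' := fun i ↦ fderiv ℝ (fderiv ℝ (chartMap (ψ i).1 p q))) (l := l) hN (fun x hx ↦ ?_)
      hA' fun x hx ↦ ?_
    · filter_upwards [hdom x hx] with a ha
      exact ((((contDiffOn_two_chartMap (ψ a.1) p q).fderiv_of_isOpen
        (isOpen_chartDomain (ψ a.1).1.continuous p q) (m := 1) (by norm_num)).differentiableOn
          (by simp)).differentiableAt
        ((isOpen_chartDomain (ψ a.1).1.continuous p q).mem_nhds ha)).hasFDerivAt
    · have hcF : ContinuousAt F (x, chartMap f p q x, A x) :=
        hFs.continuousOn.continuousAt (prod_mem_nhds ((isOpen_extChartAt_target p).mem_nhds hx.1)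
          (prod_mem_nhds ((isOpen_extChartAt_target q).mem_nhds (chartMap_mem_target hx))
            univ_mem))
      have hlim := hcF.tendsto.comp
        ((tendsto_snd (f := l)).prodMk_nhds ((hjet₀ x hx).prodMk_nhds (hA x hx)))
      simp only [Function.comp_def] at hlim
      refine hlim.congr' ?_
      filter_upwards [hdom x hx] with a ha
      exact (fderiv_fderiv_chartMap (ψ a.1) ha).symm
  have hsmooth : ContDiffOn ℝ ∞ (chartMap f p q) N :=
    contDiffOn_of_hasFDerivAt_jet hN hFs hT hu hu'
  have hcm : ContMDiffAt (𝓡 n) (𝓡 n) ∞ f p := by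
    rw [contMDiffAt_iff, hpq]
    exact ⟨hfc.continuousAt, (hsmooth.contDiffAt (hN.mem_nhds hpN)).contDiffWithinAt⟩
  refine ⟨hcm, fun v w ↦ ?_⟩
  have hmd : MDifferentiableAt (𝓡 n) (𝓡 n) f p := hcm.mdifferentiableAt (by simp)
  have hcoord : ∀ v : TangentSpace (𝓡 n) p,
      (tangentTriv q ⟨f p, mfderiv (𝓡 n) (𝓡 n) f p v⟩).2 =
        A (extChartAt (𝓡 n) p p) (tangentTriv p ⟨p, v⟩).2 := fun v ↦ by
    have := tangentTriv_tangentMap (p := p) (q := q) (w := ⟨p, v⟩) hmd hps hqs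
    rw [(hu _ hpN).fderiv] at this
    exact this
  rw [val_eq_chartMetric g q hqs, val_eq_chartMetric g p hps, hcoord, hcoord,
    ← chartMap_extChartAt f (p := p) (q := q) hps]
  exact chartMetric_eq_of_tendsto ((hcst _).eventually (hdom _ hpN)) (chartMap_mem_target hpN)
    (hjet₀' _ hpN) (hA' _ hpN) _ _

/-- Isometries whose tangent maps converge continuously at some point converge to an isometry, along
any ultrafilter. -/
theorem HasTangentLimits.exists_isometry_tendsto [T2Space M] [ConnectedSpace M] {U : Ultrafilter ι}
    {ψ : ι → g.isometryGroup} {p : M} (hp : HasTangentLimits U ψ p) :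
    ∃ φ, Tendsto ψ U (𝓝 φ) := by
  have := ChartedSpace.locallyCompactSpace (EuclideanSpace ℝ (Fin n)) M
  obtain ⟨q, hq⟩ := hp.exists_tendsto
  have hψ := fun z ↦ hp.all z
  -- The inverses converge by the same argument started at `q`; their limit will invert the limit of
  -- `ψ`.
  have hψi := fun z ↦ (hp.inv hq).all z
  choose f hf using fun z ↦ (hψ z).exists_tendsto_prod
  choose h hh using fun z ↦ (hψi z).exists_tendsto_prod
  have hfc : Continuous f := continuous_iff_continuousAt.2 fun z ↦
    continuousAt_of_tendsto_prod (F := fun i z ↦ (ψ i).1 z) (Eventually.of_forall hf)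
  have hhc : Continuous h := continuous_iff_continuousAt.2 fun z ↦
    continuousAt_of_tendsto_prod (F := fun i z ↦ (ψ i)⁻¹.1 z) (Eventually.of_forall hh)
  have hcst : ∀ z : M, Tendsto (fun i : ι ↦ (i, z)) U ((U : Filter ι) ×ˢ 𝓝 z) := fun z ↦
    tendsto_id.prodMk tendsto_const_nhds
  have hhf : Function.LeftInverse h f := fun z ↦ by
    have h1 := (hh (f z)).comp (tendsto_id.prodMk ((hf z).comp (hcst z)))
    refine tendsto_nhds_unique h1 (tendsto_const_nhds.congr fun i ↦ ?_)
    exact ((ψ i).1.symm_apply_apply z).symm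
  have hfh : Function.RightInverse h f := fun z ↦ by
    have h1 := (hf (h z)).comp (tendsto_id.prodMk ((hh z).comp (hcst z)))
    refine tendsto_nhds_unique h1 (tendsto_const_nhds.congr fun i ↦ ?_)
    exact ((ψ i).1.apply_symm_apply z).symm
  let φ : M ≃ₜ M :=
    { toFun := f, invFun := h, left_inv := hhf, right_inv := hfh,
      continuous_toFun := hfc, continuous_invFun := hhc }
  have hφ : φ ∈ g.isometryGroup := ⟨fun z ↦ (contMDiffAt_and_isometry_of_limit hψ hf hfc z).1,
    fun z ↦ (contMDiffAt_and_isometry_of_limit hψi hh hhc z).1,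
    fun z ↦ (contMDiffAt_and_isometry_of_limit hψ hf hfc z).2⟩
  refine ⟨⟨φ, hφ⟩, ?_⟩
  rw [nhds_induced, tendsto_comap_iff, ContinuousMap.tendsto_nhds_compactOpen]
  intro K hK V hV hKV
  -- Joint convergence at each point of the compact set `K` gives one set of indices valid on all of
  -- `K`, which is compact-open convergence.
  have h1 : {a : ι × M | (ψ a.1).1 a.2 ∈ V} ∈ (U : Filter ι) ×ˢ 𝓝ˢ K :=
    hK.mem_prod_nhdsSet_of_forall fun z hz ↦ (hf z).eventually (hV.mem_nhds (hKV hz))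
  exact (Eventually.curry h1).mono fun i hi z hz ↦ hi.self_of_nhdsSet z hz

/-- The Hausdorff property is needed for the ultrafilter characterization of proper maps. -/
instance [T2Space M] {k l : ℕ} : T2Space (OrthonormalFrame g k l) :=
  T2Space.of_injective_continuous OrthonormalFrame.toProd_injective continuous_induced_dom

/-- Isometries that map a convergent family of orthonormal frames to a convergent family converge,
along any ultrafilter. -/
theorem exists_isometry_tendsto_of_frame [T2Space M] [ConnectedSpace M] {k l : ℕ}
    {U : Ultrafilter ι} {ψ : ι → g.isometryGroup} {F : ι → OrthonormalFrame g k l}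
    {F₀ F₁ : OrthonormalFrame g k l} (hF : Tendsto F U (𝓝 F₀))
    (hψF : Tendsto (fun i ↦ ψ i • F i) U (𝓝 F₁)) : ∃ φ, Tendsto ψ U (𝓝 φ) := by
  have htp : Continuous (OrthonormalFrame.toProd (g := g) (k := k) (l := l)) :=
    continuous_induced_dom
  have h0 := (htp.tendsto F₀).comp hF
  have h1 := (htp.tendsto F₁).comp hψF
  have h0p : Tendsto (fun i ↦ (F i).point) U (𝓝 F₀.point) :=
    (continuous_fst.tendsto _).comp h0
  have h1p : Tendsto (fun i ↦ (ψ i).1 (F i).point) U (𝓝 F₁.point) :=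
    (continuous_fst.tendsto _).comp h1
  have h0b : ∀ j, Tendsto (fun i ↦ (F i).toProd.2 j) U (𝓝 (F₀.toProd.2 j)) := fun j ↦
    (((continuous_apply j).comp continuous_snd).tendsto _).comp h0
  have h1b : ∀ j, Tendsto (fun i ↦ (ψ i • F i).toProd.2 j) U (𝓝 (F₁.toProd.2 j)) := fun j ↦
    (((continuous_apply j).comp continuous_snd).tendsto _).comp h1
  have hs := mem_extChartAt_source (I := 𝓡 n) F₀.point
  rw [extChartAt_source] at hs
  let b : Module.Basis (Fin k ⊕ Fin l) ℝ (EuclideanSpace ℝ (Fin n)) :=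
    F₀.basis.map ((tangentTriv F₀.point).continuousLinearEquivAt ℝ F₀.point hs).toLinearEquiv
  have hev := eventually_hasTangentLimits_of_frame U ψ h0p h1p
    (e := fun i j ↦ (F i).toProd.2 j) (e' := fun j ↦ F₀.toProd.2 j) (f := fun j ↦ F₁.toProd.2 j)
    (fun _ _ ↦ rfl) (fun _ ↦ rfl) (fun _ ↦ rfl) h0b b (fun j ↦ ?_) h1b
  · exact hev.self_of_nhds.exists_isometry_tendsto
  · exact ((tangentTriv F₀.point).continuousLinearMapAt_apply_of_mem ℝ hs (F₀.basis j)).symm.trans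
      (congrFun ((tangentTriv F₀.point).coe_continuousLinearEquivAt_eq (R := ℝ) hs)
        (F₀.basis j)).symm

end LimitIsometry

end SemiRiemannianMetric

theorem theorem2p3 {n : ℕ} {M : Type*} [TopologicalSpace M] [T2Space M]
    [SecondCountableTopology M] [ConnectedSpace M]
    [ChartedSpace (EuclideanSpace ℝ (Fin n)) M] [IsManifold (𝓡 n) ∞ M]
    (g : SemiRiemannianMetric n M) (k l : ℕ) (hg : g.HasSignature k l) :
    (∀ (ψ : g.isometryGroup) (F : SemiRiemannianMetric.OrthonormalFrame g k l),
      ψ • F = F → ψ = 1) ∧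
    ProperSMul g.isometryGroup (SemiRiemannianMetric.OrthonormalFrame g k l) := by
  refine ⟨SemiRiemannianMetric.eq_one_of_smul_eq, ⟨isProperMap_iff_ultrafilter_of_t2.2
    ⟨SemiRiemannianMetric.continuous_smul_orthonormalFrame.prodMk continuous_snd, ?_⟩⟩⟩
  -- The ultrafilter lives on pairs (ψ, F), which serve as the index set; the frames already
  -- converge to `F₀`, so only the isometries need a limit.
  rintro U ⟨F₁, F₀⟩ hU
  have hF : Tendsto (fun a : g.isometryGroup × SemiRiemannianMetric.OrthonormalFrame g k l ↦ a.2)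
      U (𝓝 F₀) := (continuous_snd.tendsto _).comp hU
  have hψF : Tendsto (fun a : g.isometryGroup × SemiRiemannianMetric.OrthonormalFrame g k l ↦
      a.1 • a.2) U (𝓝 F₁) := (continuous_fst.tendsto _).comp hU
  obtain ⟨φ, hφ⟩ := SemiRiemannianMetric.exists_isometry_tendsto_of_frame hF hψF
  exact ⟨(φ, F₀), hφ.prodMk_nhds hF⟩
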